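/- Types are generated by $A ::= a \mid A\to A \mid \Box A$ from countably many atoms $a$. Modal $\lambda$-terms (with type-annotated abstractions) are generated by $$M,N ::= x \mid \lambda x^A.M \mid MN \mid M[N_1,\dots,N_k/x_1,\dots,x_k]\qquad(k\ge 0,\ x_i \text{ distinct}),$$ where the explicit substitution ($\mathsf{Let}$) $M[\vec N/\vec x]$ binds the variables of $M$, which are among $x_1,\dots,x_k$. Terms are taken modulo $\alpha$-equivalence and modulo simultaneous permutation of $N_1,\dots,N_k$ and $x_1,\dots,x_k$ in explicit substitutions. The typing rules are those of the simply typed $\lambda$-calculus (variable, abstraction, application) together with: if $\Gamma\vdash N_i:\Box A_i$ for $i=1,\dots,k$ and $x_1:A_1,\dots,x_k:A_k\vdash M:C$, then $\Gamma\vdash M[N_1,\dots,N_k/x_1,\dots,x_k]:\Box C$. The ground reduction steps are, with $\{\cdot/\cdot\}$ denoting capture-avoiding substitution: - $\beta_1$: $(\lambda x^A.M)N \rightsquigarrow M\{N/x\}$; - $\beta_2$: $M[\vec P, R[\vec N/\vec z],\vec Q/\vec x,y,\vec w]\rightsquigarrow M\{R/y\}[\vec P,\vec N,\vec Q/\vec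 x,\vec z,\vec w]$; - $\eta_1$: $M\rightsquigarrow \lambda x^A.Mx$ with $x$ fresh, if $M$ has type $A\to B$ and is not an abstraction; - $\eta_2$: $M\rightsquigarrow x[M/x]$, if $M$ has type $\Box A$ and is not an explicit substitution; - $\kappa_1$: $M[\vec P,N,\vec Q/\vec x,y,\vec z]\rightsquigarrow M[\vec P,\vec Q/\vec x,\vec z]$, if $y$ does not occur in $M$; - $\kappa_2$: $M[\vec P,N,N,\vec Q/\vec x,y_1,y_2,\vec z]\rightsquigarrow M\{v,v/y_1,y_2\}[\vec P,N,\vec Q/\vec x,v,\vec z]$ with $v$ fresh. The $\beta$- and $\kappa$-steps may be performed at every subterm (including the body $M$ and the entries $N_i$ of an explicit substitution); $\eta_1$ at every subterm except the function part $M$ of an application $MN$; $\eta_2$ at every subterm except an entry $N_i$ of an explicit substitution. For a typing context $\Gamma$, let $\rightsquigarrow_{\beta\eta\kappa}$ be the union of all these steps, where the types required by $\eta_1,\eta_2$ are those that the subterm has in the context induced by $\Gamma$ and by the binders above it (a variable $x_i$ bound by an explicit substitution has type $A_i$ where $N_i:\Box A_i$). **Theorem.** On the typable terms, $\rightsquigarrow_{\beta\eta\kappa}$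 is strongly normalizing and confluent. That is, if $\Gamma\vdash M:A$ is derivable, then there is no infinite sequence $M\rightsquigarrow_{\beta\eta\kappa}M_1\rightsquigarrow_{\beta\eta\kappa}M_2\rightsquigarrow_{\beta\eta\kappa}\cdots$, and whenever $M\rightsquigarrow_{\beta\eta\kappa}^*N_1$ and $M\rightsquigarrow_{\beta\eta\kappa}^*N_2$, there is a term $P$ with $N_1\rightsquigarrow_{\beta\eta\kappa}^*P$ and $N_2\rightsquigarrow_{\beta\eta\kappa}^*P$. -/

import Mathlib

namespace ModalLambda

/-- Types, that is, formulas `A ::= a | A → A | □ A` over countably many atoms. -/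
inductive Ty : Type
  | atom : ℕ → Ty
  | arr : Ty → Ty → Ty
  | box : Ty → Ty

/-- Raw modal lambda-terms whose free variables are among `x₀, …, xₙ₋₁`, up to renaming of bound
variables (de Bruijn indices: in the body of an abstraction, `0` is the bound variable and the
indices of the outer variables are raised by one). Abstractions carry the type of their variable.
`letb M N` is the explicit substitution `M[N₀, …, Nₖ₋₁ / x₀, …, xₖ₋₁]`, where `k = 0` is allowed;
it binds all the free variables of `M`, so that its own free variables are those of the `Nᵢ`. -/
inductive Tm : ℕ → Type
  | var {n : ℕ} : Fin n → Tm n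
  | lam {n : ℕ} : Ty → Tm (n + 1) → Tm n
  | app {n : ℕ} : Tm n → Tm n → Tm n
  | letb {n k : ℕ} : Tm k → (Fin k → Tm n) → Tm n

namespace Tm

/-- The term is an abstraction. -/
def IsLam : {n : ℕ} → Tm n → Prop
  | _, lam _ _ => True
  | _, _ => False

/-- The term is an explicit substitution. -/
def IsLet : {n : ℕ} → Tm n → Prop
  | _, letb _ _ => True
  | _, _ => False

/-- Lifting of a renaming of variables under one abstraction. -/
def liftRen {n m : ℕ} (ρ : Fin n → Fin m) : Fin (n + 1) → Fin (m + 1) :=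
  Fin.cases 0 (fun i => (ρ i).succ)

/-- Renaming of the free variables. -/
def rename : {n m : ℕ} → Tm n → (Fin n → Fin m) → Tm m
  | _, _, var i, ρ => var (ρ i)
  | _, _, lam A M, ρ => lam A (rename M (liftRen ρ))
  | _, _, app M P, ρ => app (rename M ρ) (rename P ρ)
  | _, _, letb M N, ρ => letb M (fun i => rename (N i) ρ)

/-- Lifting of a substitution under one abstraction. -/
def liftSub {n m : ℕ} (σ : Fin n → Tm m) : Fin (n + 1) → Tm (m + 1) :=
  Fin.cases (var 0) (fun i => (σ i).rename Fin.succ)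

/-- Simultaneous capture-avoiding substitution of `σ i` for the `i`-th free variable. -/
def subst : {n m : ℕ} → Tm n → (Fin n → Tm m) → Tm m
  | _, _, var i, σ => σ i
  | _, _, lam A M, σ => lam A (subst M (liftSub σ))
  | _, _, app M P, σ => app (subst M σ) (subst P σ)
  | _, _, letb M N, σ => letb M (fun i => subst (N i) σ)

/-- `M{N/x}` where `x` is the most recently bound variable of `M` (index `0`). -/
def inst {n : ℕ} (M : Tm (n + 1)) (N : Tm n) : Tm n :=
  M.subst (Fin.cases N var)

end Tm

/-- A typing context for the variables `x₀, …, xₙ₋₁`. -/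
abbrev Con (n : ℕ) : Type := Fin n → Ty

/-- The context `Γ, x : A`, where `x` gets index `0`. -/
def Con.ext {n : ℕ} (Γ : Con n) (A : Ty) : Con (n + 1) :=
  Fin.cases A Γ

/-- The natural deduction typing rules: `HasType Γ M A` is derivability of `Γ ⊢ M : A`. -/
inductive HasType : {n : ℕ} → Con n → Tm n → Ty → Prop
  | var {n : ℕ} {Γ : Con n} (i : Fin n) : HasType Γ (Tm.var i) (Γ i)
  | lam {n : ℕ} {Γ : Con n} {A C : Ty} {M : Tm (n + 1)} :
      HasType (Γ.ext A) M C → HasType Γ (Tm.lam A M) (Ty.arr A C)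
  | app {n : ℕ} {Γ : Con n} {A C : Ty} {M N : Tm n} :
      HasType Γ M (Ty.arr A C) → HasType Γ N A → HasType Γ (Tm.app M N) C
  | letb {n k : ℕ} {Γ : Con n} {Δ : Con k} {C : Ty} {M : Tm k} {N : Fin k → Tm n} :
      (∀ i, HasType Γ (N i) (Ty.box (Δ i))) → HasType Δ M C →
      HasType Γ (Tm.letb M N) (Ty.box C)

/-- The congruence generated by permuting the entries of an explicit substitution together with
the variables that they are substituted for. -/
inductive PermEq : {n : ℕ} → Tm n → Tm n → Prop
  | perm {n k : ℕ} (σ : Equiv.Perm (Fin k)) (M : Tm k) (N : Fin k → Tm n) :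
      PermEq (Tm.letb (M.rename σ) N) (Tm.letb M (fun i => N (σ i)))
  | lam {n : ℕ} {A : Ty} {M M' : Tm (n + 1)} :
      PermEq M M' → PermEq (Tm.lam A M) (Tm.lam A M')
  | app {n : ℕ} {M M' N N' : Tm n} :
      PermEq M M' → PermEq N N' → PermEq (Tm.app M N) (Tm.app M' N')
  | letb {n k : ℕ} {M M' : Tm k} {N N' : Fin k → Tm n} :
      PermEq M M' → (∀ i, PermEq (N i) (N' i)) → PermEq (Tm.letb M N) (Tm.letb M' N')
  | refl {n : ℕ} (M : Tm n) : PermEq M M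
  | symm {n : ℕ} {M N : Tm n} : PermEq M N → PermEq N M
  | trans {n : ℕ} {M N P : Tm n} : PermEq M N → PermEq N P → PermEq M P

/-- The substitution that sends variable `i` to `R`, a term in `m` new variables, and keeps the
other `k` variables; the new variables come after the old ones. -/
def graft {k m : ℕ} (i : Fin (k + 1)) (R : Tm m) : Fin (k + 1) → Tm (k + m) :=
  i.insertNth (α := fun _ => Tm (k + m)) (R.rename (Fin.natAdd k))
    (fun j => Tm.var (Fin.castAdd m j))

/-- The ground steps `β₁` and `β₂`. In `β₂` the entry at place `i` is `R[N/z]`; the entries `N`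
are put at the end, since the order of the entries does not matter up to `PermEq`. -/
inductive Beta : {n : ℕ} → Tm n → Tm n → Prop
  | beta1 {n : ℕ} (A : Ty) (M : Tm (n + 1)) (N : Tm n) :
      Beta (Tm.app (Tm.lam A M) N) (M.inst N)
  | beta2 {n k m : ℕ} (M : Tm (k + 1)) (P : Fin (k + 1) → Tm n) (i : Fin (k + 1))
      (R : Tm m) (N : Fin m → Tm n) (h : P i = Tm.letb R N) :
      Beta (Tm.letb M P) (Tm.letb (M.subst (graft i R)) (Fin.append (i.removeNth P) N))

/-- The ground steps `κ₁` and `κ₂`. In `κ₁` the variable at place `i` does not occur in the body: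
the body is a term `M` in the other variables, renumbered. In `κ₂` the entries at the two
different places `i` and `i.succAbove j` coincide; their variables are identified and the entry
at `i` is removed. -/
inductive Kappa : {n : ℕ} → Tm n → Tm n → Prop
  | kappa1 {n k : ℕ} (M : Tm k) (P : Fin (k + 1) → Tm n) (i : Fin (k + 1)) :
      Kappa (Tm.letb (M.rename i.succAbove) P) (Tm.letb M (i.removeNth P))
  | kappa2 {n k : ℕ} (M : Tm (k + 1)) (P : Fin (k + 1) → Tm n) (i : Fin (k + 1)) (j : Fin k)
      (h : P i = P (i.succAbove j)) :
      Kappa (Tm.letb M P)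
        (Tm.letb (M.rename (i.insertNth (α := fun _ => Fin k) j (fun l => l))) (i.removeNth P))

/-- Closure of a ground relation under all terms with a hole. -/
inductive Compat (R : ∀ {n : ℕ}, Tm n → Tm n → Prop) : {n : ℕ} → Tm n → Tm n → Prop
  | ground {n : ℕ} {M M' : Tm n} : R M M' → Compat R M M'
  | lam {n : ℕ} {A : Ty} {M M' : Tm (n + 1)} :
      Compat R M M' → Compat R (Tm.lam A M) (Tm.lam A M')
  | appL {n : ℕ} {M M' N : Tm n} : Compat R M M' → Compat R (Tm.app M N) (Tm.app M' N)
  | appR {n : ℕ} {M N N' : Tm n} : Compat R N N' → Compat R (Tm.app M N) (Tm.app M N')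
  | body {n k : ℕ} {M M' : Tm k} {N : Fin k → Tm n} :
      Compat R M M' → Compat R (Tm.letb M N) (Tm.letb M' N)
  | entry {n k : ℕ} {M : Tm k} {N : Fin k → Tm n} (i : Fin k) {P : Tm n} :
      Compat R (N i) P → Compat R (Tm.letb M N) (Tm.letb M (Function.update N i P))

/-- Restricted `η₁`-expansion `M ⇝ λ x. M x` of a term of arrow type that is not an abstraction,
inside a term typed in `Γ`. The Boolean is `true` exactly if the surrounding term with a hole is
the bare hole; the expansion is not allowed when the hole is the function part of an
application. -/
inductive Eta1 : {n : ℕ} → Con n → Bool → Tm n → Tm n → Prop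
  | ground {n : ℕ} {Γ : Con n} {M : Tm n} {A B : Ty} :
      HasType Γ M (Ty.arr A B) → ¬ M.IsLam →
      Eta1 Γ true M (Tm.lam A (Tm.app (M.rename Fin.succ) (Tm.var 0)))
  | lam {n : ℕ} {Γ : Con n} {b : Bool} {A : Ty} {M M' : Tm (n + 1)} :
      Eta1 (Γ.ext A) b M M' → Eta1 Γ false (Tm.lam A M) (Tm.lam A M')
  | appL {n : ℕ} {Γ : Con n} {M M' N : Tm n} :
      Eta1 Γ false M M' → Eta1 Γ false (Tm.app M N) (Tm.app M' N)
  | appR {n : ℕ} {Γ : Con n} {b : Bool} {M N N' : Tm n} :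
      Eta1 Γ b N N' → Eta1 Γ false (Tm.app M N) (Tm.app M N')
  | body {n k : ℕ} {Γ : Con n} {Δ : Con k} {b : Bool} {M M' : Tm k} {N : Fin k → Tm n} :
      (∀ i, HasType Γ (N i) (Ty.box (Δ i))) → Eta1 Δ b M M' →
      Eta1 Γ false (Tm.letb M N) (Tm.letb M' N)
  | entry {n k : ℕ} {Γ : Con n} {b : Bool} {M : Tm k} {N : Fin k → Tm n} (i : Fin k) {P : Tm n} :
      Eta1 Γ b (N i) P → Eta1 Γ false (Tm.letb M N) (Tm.letb M (Function.update N i P))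

/-- Restricted `η₂`-expansion `M ⇝ x[M/x]` of a term of boxed type that is not an explicit
substitution, inside a term typed in `Γ`. The Boolean is as in `Eta1`; the expansion is not
allowed when the hole is an entry of an explicit substitution. -/
inductive Eta2 : {n : ℕ} → Con n → Bool → Tm n → Tm n → Prop
  | ground {n : ℕ} {Γ : Con n} {M : Tm n} {A : Ty} :
      HasType Γ M (Ty.box A) → ¬ M.IsLet →
      Eta2 Γ true M (Tm.letb (Tm.var (0 : Fin 1)) (fun _ => M))
  | lam {n : ℕ} {Γ : Con n} {b : Bool} {A : Ty} {M M' : Tm (n + 1)} :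
      Eta2 (Γ.ext A) b M M' → Eta2 Γ false (Tm.lam A M) (Tm.lam A M')
  | appL {n : ℕ} {Γ : Con n} {b : Bool} {M M' N : Tm n} :
      Eta2 Γ b M M' → Eta2 Γ false (Tm.app M N) (Tm.app M' N)
  | appR {n : ℕ} {Γ : Con n} {b : Bool} {M N N' : Tm n} :
      Eta2 Γ b N N' → Eta2 Γ false (Tm.app M N) (Tm.app M N')
  | body {n k : ℕ} {Γ : Con n} {Δ : Con k} {b : Bool} {M M' : Tm k} {N : Fin k → Tm n} :
      (∀ i, HasType Γ (N i) (Ty.box (Δ i))) → Eta2 Δ b M M' →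
      Eta2 Γ false (Tm.letb M N) (Tm.letb M' N)
  | entry {n k : ℕ} {Γ : Con n} {M : Tm k} {N : Fin k → Tm n} (i : Fin k) {P : Tm n} :
      Eta2 Γ false (N i) P → Eta2 Γ false (Tm.letb M N) (Tm.letb M (Function.update N i P))

/-- One `βηκ`-step between raw terms in context `Γ`. -/
def RawStep {n : ℕ} (Γ : Con n) (M N : Tm n) : Prop :=
  Compat Beta M N ∨ (∃ b, Eta1 Γ b M N) ∨ (∃ b, Eta2 Γ b M N) ∨ Compat Kappa M N

instance permSetoid (n : ℕ) : Setoid (Tm n) where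
  r := PermEq
  iseqv := ⟨PermEq.refl, PermEq.symm, PermEq.trans⟩

/-- Modal lambda-terms: raw terms up to permutation of the entries of explicit substitutions. -/
def Term (n : ℕ) : Type := Quotient (permSetoid n)

/-- The class of a raw term. -/
def Term.mk {n : ℕ} (M : Tm n) : Term n := Quotient.mk (permSetoid n) M

/-- The type assignment `Γ ⊢ M : A` for modal lambda-terms. -/
def Typed {n : ℕ} (Γ : Con n) (M : Term n) (A : Ty) : Prop :=
  ∃ M₀ : Tm n, Term.mk M₀ = M ∧ HasType Γ M₀ A

/-- One `βηκ`-step between modal lambda-terms in context `Γ`. -/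
def Step {n : ℕ} (Γ : Con n) (M N : Term n) : Prop :=
  ∃ M₀ N₀ : Tm n, Term.mk M₀ = M ∧ Term.mk N₀ = N ∧ RawStep Γ M₀ N₀

end ModalLambda

open ModalLambda

/-!
Both halves of the theorem are read off from an interpretation of the typed terms in a simple
model of functionals; neither reducibility predicates nor critical pairs are needed. A `Model`
gives the operations needed to interpret raw terms (`Model.den`), and permuting the entries of an
explicit substitution never changes a value (`Model.den_eq_of_permEq`).

*Strong normalization.* In `costModel` the types denote functionals over `ℕ`, with `□ A` denoting
the same set as `A`. All values of terms are hereditarily strictly increasing (`Cost.Le`). An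
abstraction adds the size of its argument to its result, and an explicit substitution adds the
sizes of its entries plus one for each of them, so that nothing is forgotten when a variable does
not occur; this makes `β` and `κ` strictly decreasing. Expansions are made decreasing by charging
for them beforehand: a term in a position where it may be expanded, and which is neither an
abstraction nor an explicit substitution, has its value enlarged by `Cost.expand`, which follows
the complete `η`-expansion of a value along its type. The restrictions on expansions are exactly
what makes this consistent, since the expanded term reappears in a position where it is not
charged. Hence `cost` decreases at every step (`cost_step_lt`).

*Confluence.* By the above every typed term has a normal form, so it is enough that the normal
form is determined by a quantity that no step changes. That quantity is the value in `codeModel`,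
the full set-theoretic model over codes of terms, where `□ A` denotes the functions from `ℕ` to
the denotation of `A` and `M[N/x]` denotes `z ↦ M(N z)`: here `β`, `η` and `κ` are all equalities
(`code_rawStep`). The code of a normal term is recovered from its value by normalization by
evaluation (`den_eq_reflect_and_reify_den`). In this code the variables bound by an explicit
substitution are replaced by the codes of their entries. Since in a normal term every such
variable occurs and different entries are different terms, the code determines the term up to
permutations of the entries (`permEq_of_read_eq`).
-/

namespace ModalLambda

/-! ### Renaming, typing and subject reduction -/

theorem liftRen_comp_cases {α : Type*} {n m : ℕ} (r : Fin n → Fin m) (a : α) (ρ : Fin m → α) :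
    (fun i => (Fin.cases a ρ (Tm.liftRen r i) : α)) = Fin.cases a (fun i => ρ (r i)) := by
  funext i
  cases i using Fin.cases <;> rfl

theorem rename_id {n : ℕ} (M : Tm n) : M.rename (fun i => i) = M := by
  induction M with
  | var i => rfl
  | @lam n A M ih =>
    have : Tm.liftRen (fun i : Fin n => i) = fun i => i := by
      funext i
      cases i using Fin.cases <;> rfl
    simp only [Tm.rename, this, ih]
  | app M N ihM ihN => simp only [Tm.rename, ihM, ihN]
  | letb M N ihM ihN => simp only [Tm.rename, ihN]

theorem HasType.var_inv {n : ℕ} {Γ : Con n} {i : Fin n} {A : Ty} (h : HasType Γ (.var i) A) :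
    A = Γ i := by
  cases h; rfl

theorem HasType.lam_inv {n : ℕ} {Γ : Con n} {A B : Ty} {M : Tm (n + 1)}
    (h : HasType Γ (.lam A M) B) : ∃ C, B = .arr A C ∧ HasType (Γ.ext A) M C := by
  cases h with
  | lam h => exact ⟨_, rfl, h⟩

theorem HasType.app_inv {n : ℕ} {Γ : Con n} {C : Ty} {M N : Tm n} (h : HasType Γ (.app M N) C) :
    ∃ A, HasType Γ M (.arr A C) ∧ HasType Γ N A := by
  cases h with
  | app h₁ h₂ => exact ⟨_, h₁, h₂⟩

theorem HasType.letb_inv {n k : ℕ} {Γ : Con n} {B : Ty} {M : Tm k} {N : Fin k → Tm n}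
    (h : HasType Γ (.letb M N) B) :
    ∃ (Δ : Con k) (C : Ty), B = .box C ∧ (∀ i, HasType Γ (N i) (.box (Δ i))) ∧ HasType Δ M C := by
  cases h with
  | letb h₁ h₂ => exact ⟨_, _, rfl, h₁, h₂⟩

theorem hasType_rename {n : ℕ} (M : Tm n) : ∀ {m : ℕ} {Γ : Con m} (r : Fin n → Fin m) {A : Ty},
    HasType Γ (M.rename r) A ↔ HasType (fun i => Γ (r i)) M A := by
  induction M with
  | var i =>
    intro m Γ r A
    constructor
    · intro h; rw [h.var_inv]; exact HasType.var (Γ := fun i => Γ (r i)) i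
    · intro h; rw [h.var_inv]; exact HasType.var _
  | lam B M ih =>
    intro m Γ r A
    have key : (fun i => Γ.ext B (Tm.liftRen r i)) = Con.ext (fun i => Γ (r i)) B :=
      liftRen_comp_cases r B Γ
    constructor
    · intro h
      obtain ⟨C, rfl, h₁⟩ := HasType.lam_inv h
      rw [ih, key] at h₁
      exact h₁.lam
    · intro h
      obtain ⟨C, rfl, h₁⟩ := HasType.lam_inv h
      rw [← key, ← ih] at h₁
      exact h₁.lam
  | app M N ihM ihN =>
    intro m Γ r A
    constructor
    · intro h
      obtain ⟨B, h₁, h₂⟩ := HasType.app_inv h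
      exact .app ((ihM r).1 h₁) ((ihN r).1 h₂)
    · intro h
      obtain ⟨B, h₁, h₂⟩ := HasType.app_inv h
      exact .app ((ihM r).2 h₁) ((ihN r).2 h₂)
  | letb M N ihM ihN =>
    intro m Γ r A
    constructor
    · intro h
      obtain ⟨Δ, C, rfl, h₁, h₂⟩ := HasType.letb_inv h
      exact .letb (fun i => (ihN i r).1 (h₁ i)) h₂
    · intro h
      obtain ⟨Δ, C, rfl, h₁, h₂⟩ := HasType.letb_inv h
      exact .letb (fun i => (ihN i r).2 (h₁ i)) h₂

theorem HasType.subst {n : ℕ} {Γ : Con n} {M : Tm n} {A : Ty} (h : HasType Γ M A) :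
    ∀ {m : ℕ} {Γ' : Con m} {σ : Fin n → Tm m}, (∀ i, HasType Γ' (σ i) (Γ i)) →
      HasType Γ' (M.subst σ) A := by
  induction h with
  | var i => intro m Γ' σ hσ; exact hσ i
  | lam _ ih =>
    intro m Γ' σ hσ
    refine .lam (ih fun i => ?_)
    cases i using Fin.cases with
    | zero => exact HasType.var (Γ := Γ'.ext _) 0
    | succ i => exact (hasType_rename _ _).2 (hσ i)
  | app _ _ ihM ihN => intro m Γ' σ hσ; exact .app (ihM hσ) (ihN hσ)
  | letb _ h₂ ihN _ => intro m Γ' σ hσ; exact .letb (fun i => ihN i hσ) h₂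

/-- The type `A` of a boxed type `□ A`, and an irrelevant value at other types. -/
def Ty.unbox : Ty → Ty
  | .box A => A
  | _ => .atom 0

/-- The type of a term in a context, with an irrelevant value if the term is not typable. -/
def ty : {n : ℕ} → Tm n → Con n → Ty
  | _, .var i, Γ => Γ i
  | _, .lam A M, Γ => .arr A (ty M (Γ.ext A))
  | _, .app M _, Γ => match ty M Γ with
    | .arr _ C => C
    | _ => .atom 0
  | _, .letb M N, Γ => .box (ty M fun i => (ty (N i) Γ).unbox)

theorem HasType.ty_eq {n : ℕ} {Γ : Con n} {M : Tm n} {A : Ty} (h : HasType Γ M A) :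
    ty M Γ = A := by
  induction h with
  | var i => rfl
  | lam _ ih => simp only [ty, ih]
  | app _ _ ih _ => simp only [ty, ih]
  | letb _ _ ihN ihM => simp only [ty, ihN, Ty.unbox, ihM]

theorem HasType.unique {n : ℕ} {Γ : Con n} {M : Tm n} {A B : Ty} (h : HasType Γ M A)
    (h' : HasType Γ M B) : A = B :=
  h.ty_eq.symm.trans h'.ty_eq

theorem HasType.unique_box {n k : ℕ} {Γ : Con n} {N : Fin k → Tm n} {Δ Δ' : Con k}
    (h : ∀ i, HasType Γ (N i) (.box (Δ i))) (h' : ∀ i, HasType Γ (N i) (.box (Δ' i))) :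
    Δ = Δ' := by
  funext i
  exact Ty.box.inj ((h i).unique (h' i))

theorem ty_rename {n : ℕ} (M : Tm n) : ∀ {m : ℕ} (Γ : Con m) (r : Fin n → Fin m),
    ty (M.rename r) Γ = ty M (fun i => Γ (r i)) := by
  induction M with
  | var i => intros; rfl
  | lam A M ih =>
    intro m Γ r
    simp only [Tm.rename, ty, ih]
    congr 2
    exact liftRen_comp_cases r A Γ
  | app M N ihM ihN => intro m Γ r; simp only [Tm.rename, ty, ihM]
  | letb M N ihM ihN => intro m Γ r; simp only [Tm.rename, ty, ihN]

theorem PermEq.ty_eq {n : ℕ} {M M' : Tm n} (h : PermEq M M') : ∀ Γ, ty M Γ = ty M' Γ := by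
  induction h with
  | perm σ M N => intro Γ; simp only [ty, ty_rename]
  | lam _ ih => intro Γ; simp only [ty, ih]
  | app _ _ ihM ihN => intro Γ; simp only [ty, ihM]
  | letb _ _ ihM ihN => intro Γ; simp only [ty, ihM, ihN]
  | refl => intro Γ; rfl
  | symm _ ih => intro Γ; exact (ih Γ).symm
  | trans _ _ ih₁ ih₂ => intro Γ; exact (ih₁ Γ).trans (ih₂ Γ)

theorem PermEq.hasType_iff {n : ℕ} {M M' : Tm n} (h : PermEq M M') :
    ∀ {Γ : Con n} {A : Ty}, HasType Γ M A ↔ HasType Γ M' A := by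
  induction h with
  | perm σ M N =>
    intro Γ A
    constructor
    · intro h
      obtain ⟨Δ, C, rfl, h₁, h₂⟩ := HasType.letb_inv h
      exact .letb (fun i => h₁ (σ i)) ((hasType_rename M σ).1 h₂)
    · intro h
      obtain ⟨Δ, C, rfl, h₁, h₂⟩ := HasType.letb_inv h
      refine .letb (Δ := fun i => Δ (σ.symm i)) (fun i => ?_) ((hasType_rename M σ).2 ?_)
      · simpa using h₁ (σ.symm i)
      · simpa using h₂
  | lam _ ih =>
    intro Γ A
    constructor <;> intro h <;> obtain ⟨C, rfl, h₁⟩ := HasType.lam_inv h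
    · exact (ih.1 h₁).lam
    · exact (ih.2 h₁).lam
  | app _ _ ihM ihN =>
    intro Γ A
    constructor <;> intro h <;> obtain ⟨B, h₁, h₂⟩ := HasType.app_inv h
    · exact .app (ihM.1 h₁) (ihN.1 h₂)
    · exact .app (ihM.2 h₁) (ihN.2 h₂)
  | letb _ _ ihM ihN =>
    intro Γ A
    constructor <;> intro h <;> obtain ⟨Δ, C, rfl, h₁, h₂⟩ := HasType.letb_inv h
    · exact .letb (fun i => (ihN i).1 (h₁ i)) (ihM.1 h₂)
    · exact .letb (fun i => (ihN i).2 (h₁ i)) (ihM.2 h₂)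
  | refl => intro Γ A; rfl
  | symm _ ih => intro Γ A; exact ih.symm
  | trans _ _ ih₁ ih₂ => intro Γ A; exact ih₁.trans ih₂

/-- The substitution in `β₂` is well typed. -/
theorem HasType.graft {k m : ℕ} {Δ : Con (k + 1)} {Θ : Con m} {i : Fin (k + 1)} {R : Tm m}
    (hR : HasType Θ R (Δ i)) (j : Fin (k + 1)) :
    HasType (Fin.append (i.removeNth Δ) Θ) (graft i R j) (Δ j) := by
  cases j using Fin.succAboveCases i with
  | x =>
    rw [ModalLambda.graft, Fin.insertNth_apply_same, hasType_rename]
    simpa using hR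
  | p j =>
    rw [ModalLambda.graft, Fin.insertNth_apply_succAbove]
    have := HasType.var (Γ := Fin.append (i.removeNth Δ) Θ) (Fin.castAdd m j)
    rwa [Fin.append_left] at this

theorem HasType.beta {n : ℕ} {M M' : Tm n} (s : Beta M M') {Γ : Con n} {A : Ty}
    (h : HasType Γ M A) : HasType Γ M' A := by
  cases s with
  | beta1 B M N =>
    obtain ⟨C, h₁, h₂⟩ := h.app_inv
    obtain ⟨D, e, h₁⟩ := h₁.lam_inv
    cases e
    refine h₁.subst fun i => ?_
    cases i using Fin.cases with
    | zero => exact h₂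
    | succ i => exact .var i
  | beta2 M P i R N e =>
    obtain ⟨Δ, C, rfl, h₁, h₂⟩ := h.letb_inv
    have hi := h₁ i
    rw [e] at hi
    obtain ⟨Θ, D, e', h₃, h₄⟩ := hi.letb_inv
    cases e'
    refine .letb (Δ := Fin.append (i.removeNth Δ) Θ) (fun j => ?_) (h₂.subst fun j => h₄.graft j)
    cases j using Fin.addCases with
    | left j => simpa [Fin.removeNth] using h₁ (i.succAbove j)
    | right j => simpa using h₃ j

theorem HasType.kappa {n : ℕ} {M M' : Tm n} (s : Kappa M M') {Γ : Con n} {A : Ty}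
    (h : HasType Γ M A) : HasType Γ M' A := by
  cases s with
  | kappa1 M P i =>
    obtain ⟨Δ, C, rfl, h₁, h₂⟩ := h.letb_inv
    exact .letb (fun j => h₁ _) ((hasType_rename _ _).1 h₂)
  | kappa2 M P i j e =>
    obtain ⟨Δ, C, rfl, h₁, h₂⟩ := h.letb_inv
    refine .letb (Δ := fun l => Δ (i.succAbove l)) (fun l => h₁ _) ((hasType_rename _ _).2 ?_)
    convert h₂ using 1
    funext l
    cases l using Fin.succAboveCases i with
    | x =>
      rw [Fin.insertNth_apply_same]
      have := h₁ i
      rw [e] at this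
      exact Ty.box.inj ((h₁ _).unique this)
    | p l => rw [Fin.insertNth_apply_succAbove]

theorem HasType.compat {R : ∀ {n : ℕ}, Tm n → Tm n → Prop}
    (hR : ∀ {n : ℕ} {M M' : Tm n}, R M M' →
      ∀ {Γ : Con n} {A : Ty}, HasType Γ M A → HasType Γ M' A)
    {n : ℕ} {M M' : Tm n} (s : Compat R M M') :
    ∀ {Γ : Con n} {A : Ty}, HasType Γ M A → HasType Γ M' A := by
  induction s with
  | ground s => exact hR s
  | lam _ ih => intro Γ A h; obtain ⟨C, rfl, h₁⟩ := h.lam_inv; exact (ih h₁).lam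
  | appL _ ih => intro Γ A h; obtain ⟨C, h₁, h₂⟩ := h.app_inv; exact .app (ih h₁) h₂
  | appR _ ih => intro Γ A h; obtain ⟨C, h₁, h₂⟩ := h.app_inv; exact .app h₁ (ih h₂)
  | body _ ih => intro Γ A h; obtain ⟨Δ, C, rfl, h₁, h₂⟩ := h.letb_inv; exact .letb h₁ (ih h₂)
  | entry i _ ih =>
    intro Γ A h
    obtain ⟨Δ, C, rfl, h₁, h₂⟩ := h.letb_inv
    refine .letb (fun j => ?_) h₂
    by_cases e : j = i
    · subst e; simpa using ih (h₁ j)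
    · simpa [e] using h₁ j

theorem HasType.eta1 {n : ℕ} {Γ : Con n} {b : Bool} {M M' : Tm n} (s : Eta1 Γ b M M') :
    ∀ {A : Ty}, HasType Γ M A → HasType Γ M' A := by
  induction s with
  | ground h _ =>
    intro C hC
    obtain rfl := hC.unique h
    exact .lam (.app ((hasType_rename _ _).2 h) (HasType.var (Γ := Con.ext _ _) 0))
  | lam _ ih => intro A h; obtain ⟨C, rfl, h₁⟩ := h.lam_inv; exact (ih h₁).lam
  | appL _ ih => intro A h; obtain ⟨C, h₁, h₂⟩ := h.app_inv; exact .app (ih h₁) h₂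
  | appR _ ih => intro A h; obtain ⟨C, h₁, h₂⟩ := h.app_inv; exact .app h₁ (ih h₂)
  | body hN _ ih =>
    intro A h
    obtain ⟨Δ, C, rfl, h₁, h₂⟩ := h.letb_inv
    obtain rfl := HasType.unique_box h₁ hN
    exact .letb h₁ (ih h₂)
  | entry i _ ih =>
    intro A h
    obtain ⟨Δ, C, rfl, h₁, h₂⟩ := h.letb_inv
    refine .letb (fun j => ?_) h₂
    by_cases e : j = i
    · subst e; simpa using ih (h₁ j)
    · simpa [e] using h₁ j

theorem HasType.eta2 {n : ℕ} {Γ : Con n} {b : Bool} {M M' : Tm n} (s : Eta2 Γ b M M') :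
    ∀ {A : Ty}, HasType Γ M A → HasType Γ M' A := by
  induction s with
  | @ground n Γ M A h _ =>
    intro C hC
    obtain rfl := hC.unique h
    exact .letb (Δ := fun _ => A) (fun _ => h) (HasType.var (Γ := fun _ : Fin 1 => A) 0)
  | lam _ ih => intro A h; obtain ⟨C, rfl, h₁⟩ := h.lam_inv; exact (ih h₁).lam
  | appL _ ih => intro A h; obtain ⟨C, h₁, h₂⟩ := h.app_inv; exact .app (ih h₁) h₂
  | appR _ ih => intro A h; obtain ⟨C, h₁, h₂⟩ := h.app_inv; exact .app h₁ (ih h₂)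
  | body hN _ ih =>
    intro A h
    obtain ⟨Δ, C, rfl, h₁, h₂⟩ := h.letb_inv
    obtain rfl := HasType.unique_box h₁ hN
    exact .letb h₁ (ih h₂)
  | entry i _ ih =>
    intro A h
    obtain ⟨Δ, C, rfl, h₁, h₂⟩ := h.letb_inv
    refine .letb (fun j => ?_) h₂
    by_cases e : j = i
    · subst e; simpa using ih (h₁ j)
    · simpa [e] using h₁ j

/-- Subject reduction. -/
theorem HasType.rawStep {n : ℕ} {Γ : Con n} {M M' : Tm n} {A : Ty} (h : HasType Γ M A)
    (s : RawStep Γ M M') : HasType Γ M' A := by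
  rcases s with s | ⟨b, s⟩ | ⟨b, s⟩ | s
  · exact h.compat HasType.beta s
  · exact h.eta1 s
  · exact h.eta2 s
  · exact h.compat HasType.kappa s

/-! ### Interpretations of typed terms -/

/-- The term is an abstraction or an explicit substitution. -/
def Tm.isIntro : {n : ℕ} → Tm n → Bool
  | _, .lam _ _ => true
  | _, .letb _ _ => true
  | _, _ => false

theorem Tm.isIntro_rename {n m : ℕ} (M : Tm n) (r : Fin n → Fin m) :
    (M.rename r).isIntro = M.isIntro := by
  cases M <;> rfl

theorem PermEq.isIntro_eq {n : ℕ} {M M' : Tm n} (h : PermEq M M') : M.isIntro = M'.isIntro := by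
  induction h with
  | symm _ ih => exact ih.symm
  | trans _ _ ih₁ ih₂ => exact ih₁.trans ih₂
  | _ => rfl

theorem isIntro_eq_false_of_arr {n : ℕ} {Γ : Con n} {M : Tm n} {A B : Ty}
    (h : HasType Γ M (.arr A B)) (h' : ¬ M.IsLam) : M.isIntro = false := by
  cases M with
  | lam => exact (h' trivial).elim
  | letb =>
    obtain ⟨_, _, e, _⟩ := h.letb_inv
    cases e
  | _ => rfl

theorem isIntro_eq_false_of_box {n : ℕ} {Γ : Con n} {M : Tm n} {A : Ty}
    (h : HasType Γ M (.box A)) (h' : ¬ M.IsLet) : M.isIntro = false := by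
  cases M with
  | letb => exact (h' trivial).elim
  | lam =>
    obtain ⟨_, e, _⟩ := h.lam_inv
    cases e
  | _ => rfl

/-- An applicative structure in which terms can be interpreted. The operation `pos b` is applied
to the value of a term that is neither the function part of an application nor an entry of an
explicit substitution; the Boolean says whether the term is an abstraction or an explicit
substitution. -/
structure Model where
  D : Ty → Type
  dflt : ∀ A, D A
  lam : ∀ {A B : Ty}, (D A → D B) → D (.arr A B)
  app : ∀ {A B : Ty}, D (.arr A B) → D A → D B
  box : ∀ {k : ℕ} {C : Ty}, (Fin k → (A : Ty) × D (.box A)) →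
    ((Fin k → (A : Ty) × D A) → D C) → D (.box C)
  pos : ∀ {A : Ty}, Bool → D A → D A
  box_perm : ∀ {k : ℕ} {C : Ty} (σ : Equiv.Perm (Fin k)) (v : Fin k → (A : Ty) × D (.box A))
    (f : (Fin k → (A : Ty) × D A) → D C),
    box v (fun ξ => f fun i => ξ (σ i)) = box (fun i => v (σ i)) f

namespace Model

variable (𝓜 : Model)

/-- Environments: every variable is given a type and a value of that type. -/
abbrev Env (n : ℕ) : Type := Fin n → (A : Ty) × 𝓜.D A

variable {𝓜}

/-- The typing context underlying an environment. -/
def Env.con {n : ℕ} (ρ : 𝓜.Env n) : Con n := fun i => (ρ i).1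

/-- Extension of an environment by a value for the variable with index `0`. -/
def Env.ext {n : ℕ} (ρ : 𝓜.Env n) {A : Ty} (a : 𝓜.D A) : 𝓜.Env (n + 1) :=
  Fin.cases ⟨A, a⟩ ρ

theorem Env.con_ext {n : ℕ} (ρ : 𝓜.Env n) {A : Ty} (a : 𝓜.D A) :
    (ρ.ext a).con = ρ.con.ext A := by
  funext i
  cases i using Fin.cases <;> rfl

theorem Env.hasType_ext {n : ℕ} {ρ : 𝓜.Env n} {A B : Ty} {M : Tm (n + 1)} (a : 𝓜.D A)
    (h : HasType (ρ.con.ext A) M B) : HasType (ρ.ext a).con M B := by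
  rwa [con_ext]

variable (𝓜)

open Classical in
/-- The value of a term, as an element of the interpretation of a prescribed type; irrelevant
unless the term has this type in the context underlying the environment. -/
noncomputable def den : {n : ℕ} → Tm n → 𝓜.Env n → (A : Ty) → 𝓜.D A
  | _, .var i, ρ, A => if h : (ρ i).1 = A then h ▸ (ρ i).2 else 𝓜.dflt A
  | _, .lam _ M, ρ, T => match T with
    | .arr _ B => 𝓜.lam fun a => 𝓜.pos M.isIntro (den M (Env.ext ρ a) B)
    | T => 𝓜.dflt T
  | _, .app M N, ρ, C => 𝓜.app (den M ρ (.arr (ty N (Env.con ρ)) C))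
      (𝓜.pos N.isIntro (den N ρ (ty N (Env.con ρ))))
  | _, .letb M N, ρ, T => match T with
    | .box C => 𝓜.box
        (fun i => ⟨(ty (N i) (Env.con ρ)).unbox, den (N i) ρ (.box (ty (N i) (Env.con ρ)).unbox)⟩)
        (fun ξ => 𝓜.pos M.isIntro (den M ξ C))
    | T => 𝓜.dflt T

variable {𝓜}

theorem den_var {n : ℕ} {i : Fin n} {ρ : 𝓜.Env n} {A : Ty} {a : 𝓜.D A} (h : ρ i = ⟨A, a⟩) :
    𝓜.den (.var i) ρ A = a := by
  rw [den]
  generalize ρ i = x at h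
  subst h
  exact dif_pos rfl

theorem den_lam {n : ℕ} {A B C : Ty} (M : Tm (n + 1)) (ρ : 𝓜.Env n) :
    𝓜.den (.lam A M) ρ (.arr B C) = 𝓜.lam fun a => 𝓜.pos M.isIntro (𝓜.den M (ρ.ext a) C) := rfl

theorem den_app_of_ty {n : ℕ} {A : Ty} (C : Ty) {M N : Tm n} {ρ : 𝓜.Env n}
    (h : ty N ρ.con = A) :
    𝓜.den (.app M N) ρ C = 𝓜.app (𝓜.den M ρ (.arr A C)) (𝓜.pos N.isIntro (𝓜.den N ρ A)) := by
  subst h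
  rfl

theorem den_letb_of_ty {n k : ℕ} {Δ : Con k} (C : Ty) {M : Tm k} {N : Fin k → Tm n}
    {ρ : 𝓜.Env n} (h : ∀ i, (ty (N i) ρ.con).unbox = Δ i) :
    𝓜.den (.letb M N) ρ (.box C) = 𝓜.box (fun i => ⟨Δ i, 𝓜.den (N i) ρ (.box (Δ i))⟩)
      (fun ξ => 𝓜.pos M.isIntro (𝓜.den M ξ C)) := by
  obtain rfl : (fun i => (ty (N i) ρ.con).unbox) = Δ := funext h
  rfl

theorem den_app {n : ℕ} {A C : Ty} {M N : Tm n} {ρ : 𝓜.Env n} (h : HasType ρ.con N A) :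
    𝓜.den (.app M N) ρ C = 𝓜.app (𝓜.den M ρ (.arr A C)) (𝓜.pos N.isIntro (𝓜.den N ρ A)) :=
  den_app_of_ty C h.ty_eq

theorem den_letb {n k : ℕ} {Δ : Con k} {C : Ty} {M : Tm k} {N : Fin k → Tm n} {ρ : 𝓜.Env n}
    (h : ∀ i, HasType ρ.con (N i) (.box (Δ i))) :
    𝓜.den (.letb M N) ρ (.box C) = 𝓜.box (fun i => ⟨Δ i, 𝓜.den (N i) ρ (.box (Δ i))⟩)
      (fun ξ => 𝓜.pos M.isIntro (𝓜.den M ξ C)) :=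
  den_letb_of_ty C fun i => by rw [(h i).ty_eq]; rfl

theorem den_rename {n : ℕ} (M : Tm n) : ∀ {m : ℕ} (r : Fin n → Fin m) (ρ : 𝓜.Env m) (A : Ty),
    𝓜.den (M.rename r) ρ A = 𝓜.den M (fun i => ρ (r i)) A := by
  induction M with
  | var i => intros; rfl
  | lam B M ih =>
    intro m r ρ A
    cases A with
    | arr A C =>
      simp only [Tm.rename, den_lam, ih, Tm.isIntro_rename]
      congr 1
      funext a
      congr 2
      exact liftRen_comp_cases r _ ρ
    | _ => rfl
  | app M N ihM ihN =>
    intro m r ρ A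
    rw [Tm.rename, den_app_of_ty A (ty_rename N ρ.con r), den_app_of_ty A rfl, ihM, ihN,
      Tm.isIntro_rename]
    rfl
  | letb M N ihM ihN =>
    intro m r ρ A
    cases A with
    | box C =>
      rw [Tm.rename, den_letb_of_ty C fun i => congrArg Ty.unbox (ty_rename (N i) ρ.con r),
        den_letb_of_ty C fun i => rfl]
      simp only [ihN]
      rfl
    | _ => rfl

theorem den_eq_of_permEq {n : ℕ} {M M' : Tm n} (h : PermEq M M') : ∀ (ρ : 𝓜.Env n) (A : Ty),
    𝓜.den M ρ A = 𝓜.den M' ρ A := by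
  induction h with
  | perm σ M N =>
    intro ρ A
    cases A with
    | box C =>
      simp only [den, den_rename, Tm.isIntro_rename]
      exact 𝓜.box_perm σ _ fun ξ => 𝓜.pos M.isIntro (𝓜.den M ξ C)
    | _ => rfl
  | lam h ih =>
    intro ρ A
    cases A with
    | arr A C => simp only [den_lam, ih, h.isIntro_eq]
    | _ => rfl
  | app _ h ihM ihN =>
    intro ρ A
    rw [den_app_of_ty A (h.ty_eq ρ.con), den_app_of_ty A rfl, ihM, ihN, h.isIntro_eq]
  | letb h hN ihM ihN =>
    intro ρ A
    cases A with
    | box C =>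
      rw [den_letb_of_ty C fun i => congrArg Ty.unbox ((hN i).ty_eq ρ.con),
        den_letb_of_ty C fun i => rfl]
      simp only [ihM, ihN, h.isIntro_eq]
    | _ => rfl
  | refl => intros; rfl
  | symm _ ih => intro ρ A; exact (ih ρ A).symm
  | trans _ _ ih₁ ih₂ => intro ρ A; exact (ih₁ ρ A).trans (ih₂ ρ A)

/-- The value of a term with the operation `pos` applied to it. -/
noncomputable abbrev pden {n : ℕ} (M : Tm n) (ρ : 𝓜.Env n) (A : Ty) : 𝓜.D A :=
  𝓜.pos M.isIntro (𝓜.den M ρ A)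

end Model

/-! ### The cost model -/

/-- Interpretation of types by functionals over the natural numbers. -/
def Cost : Ty → Type
  | .atom _ => ℕ
  | .arr A B => Cost A → Cost B
  | .box A => Cost A

namespace Cost

/-- Pointwise addition of a number. -/
def shift : {A : Ty} → ℕ → Cost A → Cost A
  | .atom _, k, a => (show ℕ from a) + k
  | .arr _ _, k, f => fun a => shift k (f a)
  | .box A, k, a => shift (A := A) k a

/-- The maps `collapse` and `zero`, defined together by recursion on the type. -/
def collapseZero : (A : Ty) → (Cost A → ℕ) × Cost A
  | .atom _ => (fun a => a, (0 : ℕ))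
  | .arr A B => (fun f => (collapseZero B).1 (f (collapseZero A).2),
      fun a => shift ((collapseZero A).1 a) (collapseZero B).2)
  | .box A => collapseZero A

/-- The number assigned to a functional: its value at least arguments. -/
def collapse {A : Ty} (a : Cost A) : ℕ := (collapseZero A).1 a

/-- The least hereditarily strictly increasing functional. -/
def zero (A : Ty) : Cost A := (collapseZero A).2

/-- The value of a term on which full `η`-expansion is yet to be performed. -/
def expand : {A : Ty} → Cost A → Cost A
  | .atom _, a => a
  | .arr _ _, f => fun a => shift (collapse a + 2) (expand (f (expand a)))
  | .box A, a => shift (A := A) (collapse (A := A) a + 3) (expand (A := A) a)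

/-- `Le n a b` says that `a + n ≤ b`, pointwise and hereditarily. The functionals with `Le 0 a a`
are the hereditarily strictly increasing ones. -/
def Le : {A : Ty} → ℕ → Cost A → Cost A → Prop
  | .atom _, n, a, b => (show ℕ from a) + n ≤ (show ℕ from b)
  | .arr A B, n, f, g => ∀ (m : ℕ) (a b : Cost A), Le 0 a a → Le 0 b b → Le m a b →
      Le (A := B) (n + m) (f a) (g b)
  | .box A, n, a, b => Le (A := A) n a b

/-- The functional is hereditarily strictly increasing. -/
abbrev Valid {A : Ty} (a : Cost A) : Prop := Le 0 a a

theorem shift_zero : ∀ {A : Ty} (a : Cost A), shift 0 a = a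
  | .atom _, _ => rfl
  | .arr _ _, _ => funext fun _ => shift_zero _
  | .box A, a => shift_zero (A := A) a

theorem le_shift : ∀ {A : Ty} {n p j k : ℕ} {a b : Cost A}, Le n a b → p + j ≤ n + k →
    Le p (shift j a) (shift k b)
  | .atom _, n, p, j, k, a, b, h, e => by
    change (_ + _) + _ ≤ _ + _
    change _ + _ ≤ _ at h
    omega
  | .arr A B, n, p, j, k, a, b, h, e => fun m x y hx hy hm =>
    le_shift (h m x y hx hy hm) (by omega)
  | .box A, _, _, _, _, _, _, h, e => le_shift (A := A) h e

theorem Le.mono {A : Ty} {n p : ℕ} {a b : Cost A} (h : Le n a b) (e : p ≤ n) : Le p a b := by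
  have := le_shift (j := 0) (k := 0) h (show p + 0 ≤ n + 0 by omega)
  rwa [shift_zero, shift_zero] at this

theorem le_shift_right {A : Ty} {n p k : ℕ} {a b : Cost A} (h : Le n a b) (e : p ≤ n + k) :
    Le p a (shift k b) := by
  have := le_shift (j := 0) (k := k) h (show p + 0 ≤ n + k by omega)
  rwa [shift_zero] at this

theorem Le.trans : ∀ {A : Ty} {n m : ℕ} {a b c : Cost A}, Le n a b → Le m b c → Valid b →
    Le (n + m) a c
  | .atom _, n, m, a, b, c, h₁, h₂, _ => by
    change _ + _ ≤ _ at h₁ h₂ ⊢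
    omega
  | .arr A B, n, m, a, b, c, h₁, h₂, hb => fun p x y hx hy hxy => by
    have := Le.trans (h₁ p x y hx hy hxy) (h₂ 0 y y hy hy hy) (hb 0 y y hy hy hy)
    convert this using 1
    omega
  | .box A, _, _, _, _, _, h₁, h₂, hb => Le.trans (A := A) h₁ h₂ hb

theorem valid_zero_and_le_collapse : ∀ A : Ty, Valid (zero A) ∧
    ∀ (n : ℕ) (a b : Cost A), Le n a b → collapse a + n ≤ collapse b
  | .atom _ => ⟨le_refl (0 : ℕ), fun _ _ _ h => h⟩
  | .arr A B => by
    obtain ⟨hA, hA'⟩ := valid_zero_and_le_collapse A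
    obtain ⟨hB, hB'⟩ := valid_zero_and_le_collapse B
    refine ⟨fun m x y hx hy hm => ?_, fun n f g h => ?_⟩
    · have := hA' _ _ _ hm
      exact le_shift hB (by change _ + collapse x ≤ _ + collapse y; omega)
    · exact hB' _ _ _ (h 0 _ _ hA hA hA)
  | .box A => valid_zero_and_le_collapse A

theorem valid_zero (A : Ty) : Valid (zero A) := (valid_zero_and_le_collapse A).1

theorem Le.collapse {A : Ty} {n : ℕ} {a b : Cost A} (h : Le n a b) :
    collapse a + n ≤ Cost.collapse b := (valid_zero_and_le_collapse A).2 n a b h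

theorem collapse_shift : ∀ {A : Ty} (k : ℕ) (a : Cost A), collapse (shift k a) = collapse a + k
  | .atom _, _, _ => rfl
  | .arr _ B, k, f => collapse_shift (A := B) k (f (zero _))
  | .box A, k, a => collapse_shift (A := A) k a

theorem Le.expand : ∀ {A : Ty} {n : ℕ} {a b : Cost A}, Le n a b →
    Le n (expand a) (Cost.expand b)
  | .atom _, _, _, _, h => h
  | .arr A B, n, f, g, h => fun m x y hx hy hxy => by
    have := hxy.collapse
    exact le_shift (h _ _ _ hx.expand hy.expand hxy.expand).expand (by omega)
  | .box A, n, a, b, h => by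
    have := Le.collapse (A := A) h
    exact le_shift (Le.expand (A := A) h) (by omega)

/-- Charging for expansions never lowers a value. -/
theorem Valid.le_expand : ∀ {A : Ty} {a : Cost A}, Valid a → Le 0 a (Cost.expand a)
  | .atom _, _, h => h
  | .arr A B, f, h => fun m x y hx hy hxy => by
    have hxy' : Le m x (Cost.expand y) := hxy.trans (Valid.le_expand hy) hy
    have h₁ := h _ _ _ hx (Le.expand hy) hxy'
    have h₂ := h _ _ _ (Le.expand hy) (Le.expand hy) (Le.expand hy)
    exact le_shift_right (h₁.trans (Valid.le_expand h₂) h₂) (by omega)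
  | .box A, a, h => le_shift_right (Valid.le_expand (A := A) h) (by omega)

/-- Functionals are compared pointwise. -/
theorem le_of_pointwise {A B : Ty} {n : ℕ} {f g : Cost (.arr A B)} (hg : Valid g)
    (h : ∀ a, Valid a → Le (A := B) n (f a) (g a)) : Le n f g := fun m a b ha hb hab => by
  have := (h a ha).trans (hg m a b ha hb hab) (hg 0 a a ha ha ha)
  convert this using 1
  omega

end Cost

open Cost

/-- Every abstraction adds the size of its argument and every explicit substitution the sizes of
its entries, so that no subterm is forgotten; a term in a position where expansions are allowed
is charged in advance for all its expansions. -/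
def costModel : Model where
  D := Cost
  dflt := zero
  lam F := fun a => shift (collapse a + 1) (F a)
  app f a := f a
  box {k C} v f := shift (A := C) (∑ i, (collapse (v i).2 + 1) + 1) (f fun i => ⟨(v i).1, (v i).2⟩)
  pos b a := bif b then a else expand a
  box_perm σ v f := by
    rw [← Equiv.sum_comp σ]

theorem Cost.Le.pos {A : Ty} {n : ℕ} {b : Bool} {a a' : Cost A} (h : Le n a a') :
    Le n (costModel.pos b a) (costModel.pos b a') := by
  cases b
  · exact h.expand
  · exact h

theorem Cost.Valid.le_pos {A : Ty} {a : Cost A} (h : Valid a) (b : Bool) :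
    Le 0 a (costModel.pos b a) := by
  cases b
  · exact h.le_expand
  · exact h

/-- Becoming an abstraction or an explicit substitution only lowers the charge for expansions. -/
theorem Cost.Le.pos_of_imp {A : Ty} {n : ℕ} {b b' : Bool} {a a' : Cost A} (h : Le n a a')
    (ha' : Valid a') (hb : b' = true → b = true) :
    Le n (costModel.pos b a) (costModel.pos b' a') := by
  cases b' with
  | true => rw [hb rfl]; exact h
  | false =>
    cases b with
    | true => exact h.trans ha'.le_expand ha'
    | false => exact h.expand

/-- Two valid environments for the same context that are related pointwise. -/
def EnvLe {n : ℕ} (ρ ρ' : costModel.Env n) : Prop :=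
  ∀ i, ∃ (A : Ty) (a b : Cost A), ρ i = ⟨A, a⟩ ∧ ρ' i = ⟨A, b⟩ ∧ Valid a ∧ Valid b ∧ Le 0 a b

/-- All values of the environment are hereditarily strictly increasing. -/
def EnvValid {n : ℕ} (ρ : costModel.Env n) : Prop := ∀ i, Valid (ρ i).2

theorem EnvValid.envLe {n : ℕ} {ρ : costModel.Env n} (h : EnvValid ρ) : EnvLe ρ ρ :=
  fun i => ⟨_, _, _, rfl, rfl, h i, h i, h i⟩

theorem EnvLe.left {n : ℕ} {ρ ρ' : costModel.Env n} (h : EnvLe ρ ρ') : EnvValid ρ := fun i => by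
  obtain ⟨A, a, b, e, -, ha, -⟩ := h i
  rw [e]; exact ha

theorem EnvLe.right {n : ℕ} {ρ ρ' : costModel.Env n} (h : EnvLe ρ ρ') : EnvValid ρ' := fun i => by
  obtain ⟨A, a, b, -, e, -, hb, -⟩ := h i
  rw [e]; exact hb

theorem EnvLe.con_eq {n : ℕ} {ρ ρ' : costModel.Env n} (h : EnvLe ρ ρ') : ρ.con = ρ'.con := by
  funext i
  obtain ⟨A, a, b, e, e', -⟩ := h i
  simp only [Model.Env.con, e, e']

theorem EnvLe.ext {n : ℕ} {ρ ρ' : costModel.Env n} (h : EnvLe ρ ρ') {A : Ty} {a b : Cost A}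
    (ha : Valid a) (hb : Valid b) (hab : Le 0 a b) :
    EnvLe (Model.Env.ext (𝓜 := costModel) ρ a) (Model.Env.ext (𝓜 := costModel) ρ' b) := by
  intro i
  cases i using Fin.cases with
  | zero => exact ⟨A, a, b, rfl, rfl, ha, hb, hab⟩
  | succ i => exact h i

theorem EnvValid.ext {n : ℕ} {ρ : costModel.Env n} (h : EnvValid ρ) {A : Ty} {a : Cost A}
    (ha : Valid a) : EnvValid (Model.Env.ext (𝓜 := costModel) ρ a) :=
  (h.envLe.ext ha ha ha).left

theorem den_box_apply {n k : ℕ} {Δ : Con k} {C : Ty} {M : Tm k} {N : Fin k → Tm n}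
    {ρ : costModel.Env n} (h : ∀ i, HasType ρ.con (N i) (.box (Δ i))) :
    costModel.den (.letb M N) ρ (.box C) =
      shift (A := C) (∑ i, (collapse (costModel.den (N i) ρ (.box (Δ i))) + 1) + 1)
        (costModel.pden M (fun i => ⟨Δ i, costModel.den (N i) ρ (.box (Δ i))⟩) C) :=
  Model.den_letb h

/-- Values are monotone in the environment. With two equal environments this says that values are
hereditarily strictly increasing. -/
theorem den_mono {n : ℕ} (M : Tm n) : ∀ {ρ ρ' : costModel.Env n} {A : Ty}, HasType ρ.con M A →
    EnvLe ρ ρ' → Le 0 (costModel.den M ρ A) (costModel.den M ρ' A) := by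
  induction M with
  | var i =>
    intro ρ ρ' A h hρ
    obtain ⟨B, a, b, e, e', -, -, hab⟩ := hρ i
    obtain rfl : A = B := by rw [h.var_inv, Model.Env.con, e]
    rw [Model.den_var e, Model.den_var e']
    exact hab
  | lam B M ih =>
    intro ρ ρ' A h hρ
    obtain ⟨C, rfl, h₁⟩ := h.lam_inv
    intro m a b ha hb hab
    have hc := hab.collapse
    exact le_shift (Cost.Le.pos (ih (Model.Env.hasType_ext (𝓜 := costModel) a h₁)
      (hρ.ext ha hb (hab.mono (Nat.zero_le _))))) (by omega)
  | app M N ihM ihN =>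
    intro ρ ρ' A h hρ
    obtain ⟨B, h₁, h₂⟩ := h.app_inv
    have h₂' := h₂
    rw [hρ.con_eq] at h₂'
    rw [Model.den_app h₂, Model.den_app h₂']
    exact ihM h₁ hρ 0 _ _ (ihN h₂ hρ.left.envLe).pos (ihN h₂' hρ.right.envLe).pos (ihN h₂ hρ).pos
  | letb M N ihM ihN =>
    intro ρ ρ' A h hρ
    obtain ⟨Δ, C, rfl, h₁, h₂⟩ := h.letb_inv
    have h₁' := h₁
    rw [hρ.con_eq] at h₁'
    rw [den_box_apply h₁, den_box_apply h₁']
    have hs : ∑ i, (collapse (costModel.den (N i) ρ (.box (Δ i))) + 1) ≤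
        ∑ i, (collapse (costModel.den (N i) ρ' (.box (Δ i))) + 1) :=
      Finset.sum_le_sum fun i _ => Nat.succ_le_succ (ihN i (h₁ i) hρ).collapse
    refine le_shift (A := C) (Cost.Le.pos (ihM ?_ fun i => ?_)) (by omega)
    · exact h₂
    exact ⟨Δ i, _, _, rfl, rfl, ihN i (h₁ i) hρ.left.envLe, ihN i (h₁' i) hρ.right.envLe,
      ihN i (h₁ i) hρ⟩

theorem valid_den {n : ℕ} {M : Tm n} {ρ : costModel.Env n} {A : Ty} (h : HasType ρ.con M A)
    (hρ : EnvValid ρ) : Valid (costModel.den M ρ A) := den_mono M h hρ.envLe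

theorem valid_pden {n : ℕ} {M : Tm n} {ρ : costModel.Env n} {A : Ty} (h : HasType ρ.con M A)
    (hρ : EnvValid ρ) : Valid (costModel.pden M ρ A) := (valid_den h hρ).pos

/-- The value of a term under a substitution is at most its value in an environment that
dominates the values of the substituted terms. Only an inequality holds: a substituted
abstraction no longer needs to be expanded. -/
theorem den_subst_le {n : ℕ} (M : Tm n) : ∀ {m : ℕ} {ρ : costModel.Env m} {σ : Fin n → Tm m}
    {ξ : costModel.Env n} {A : Ty}, HasType ξ.con M A → EnvValid ρ →
    (∀ i, ∃ (B : Ty) (b : Cost B), ξ i = ⟨B, b⟩ ∧ HasType ρ.con (σ i) B ∧ Valid b ∧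
      Le 0 (costModel.den (σ i) ρ B) b) →
    Le 0 (costModel.den (M.subst σ) ρ A) (costModel.den M ξ A) ∧
      Le 0 (costModel.pden (M.subst σ) ρ A) (costModel.pden M ξ A) := by
  induction M with
  | var i =>
    intro m ρ σ ξ A h hρ hσ
    obtain ⟨B, b, e, hi, hb, hle⟩ := hσ i
    obtain rfl : A = B := by rw [h.var_inv, Model.Env.con, e]
    rw [Model.pden, Model.pden, Model.den_var e]
    exact ⟨hle, hle.pos_of_imp hb (fun h => by cases h)⟩
  | lam B M ih =>
    intro m ρ σ ξ A h hρ hσ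
    obtain ⟨C, rfl, h₁⟩ := h.lam_inv
    refine (and_self_iff).2 fun m a b ha hb hab => ?_
    have hc := hab.collapse
    refine le_shift (ih (Model.Env.hasType_ext (𝓜 := costModel) b h₁) (hρ.ext ha) fun i => ?_).2
      (by omega)
    · cases i using Fin.cases with
      | zero =>
        refine ⟨B, b, rfl, ?_, hb, ?_⟩
        · exact HasType.var (Γ := Model.Env.con (Model.Env.ext (𝓜 := costModel) ρ a)) 0
        · change Le 0 (costModel.den (.var 0) (Model.Env.ext (𝓜 := costModel) ρ a) B) b
          rw [Model.den_var (a := a) rfl]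
          exact hab.mono (Nat.zero_le _)
      | succ i =>
        obtain ⟨B', b', e, hi, hb, hle⟩ := hσ i
        refine ⟨B', b', e, (hasType_rename _ _).2 hi, hb, ?_⟩
        change Le 0 (costModel.den ((σ i).rename Fin.succ) _ _) _
        rw [Model.den_rename]
        exact hle
  | app M N ihM ihN =>
    intro m ρ σ ξ A h hρ hσ
    obtain ⟨B, h₁, h₂⟩ := h.app_inv
    have hξ : EnvValid ξ := fun i => by
      obtain ⟨B, b, e, -, hb, -⟩ := hσ i
      rw [e]; exact hb
    have hσ' : ∀ i, HasType ρ.con (σ i) (ξ.con i) := fun i => by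
      obtain ⟨B, b, e, hi, -⟩ := hσ i
      rwa [Model.Env.con, e]
    have h₂' := h₂.subst hσ'
    have : Le 0 (costModel.den ((Tm.app M N).subst σ) ρ A) (costModel.den (.app M N) ξ A) := by
      rw [Tm.subst, Model.den_app h₂, Model.den_app h₂']
      exact (ihM h₁ hρ hσ).1 0 _ _ (valid_pden h₂' hρ) (valid_pden h₂ hξ) (ihN h₂ hρ hσ).2
    exact ⟨this, this.pos⟩
  | letb M N ihM ihN =>
    intro m ρ σ ξ A h hρ hσ
    obtain ⟨Δ, C, rfl, h₁, h₂⟩ := h.letb_inv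
    have hξ : EnvValid ξ := fun i => by
      obtain ⟨B, b, e, -, hb, -⟩ := hσ i
      rw [e]; exact hb
    have hσ' : ∀ i, HasType ρ.con (σ i) (ξ.con i) := fun i => by
      obtain ⟨B, b, e, hi, -⟩ := hσ i
      rwa [Model.Env.con, e]
    have h₁' := fun i => (h₁ i).subst hσ'
    refine (and_self_iff).2 ?_
    rw [Tm.subst, den_box_apply h₁, den_box_apply h₁']
    have hs : ∑ i, (collapse (costModel.den ((N i).subst σ) ρ (.box (Δ i))) + 1) ≤
        ∑ i, (collapse (costModel.den (N i) ξ (.box (Δ i))) + 1) :=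
      Finset.sum_le_sum fun i _ => Nat.succ_le_succ (ihN i (h₁ i) hρ hσ).1.collapse
    refine le_shift (A := C) (Cost.Le.pos (den_mono M ?_ fun i => ?_)) (by omega)
    · exact h₂
    exact ⟨Δ i, _, _, rfl, rfl, valid_den (h₁' i) hρ, valid_den (h₁ i) hξ,
      (ihN i (h₁ i) hρ hσ).1⟩

/-! ### Strong normalization: every step decreases the cost -/

theorem pden_lt {n : ℕ} {M M' : Tm n} {ρ : costModel.Env n} {A : Ty} (h : HasType ρ.con M A)
    (hρ : EnvValid ρ) (hM : M.isIntro = true → M'.isIntro = true)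
    (hlt : Le 1 (costModel.den M' ρ A) (costModel.den M ρ A)) :
    Le 1 (costModel.pden M' ρ A) (costModel.pden M ρ A) :=
  hlt.pos_of_imp (valid_den h hρ) hM

theorem den_lam_lt {n : ℕ} {A C : Ty} {M M' : Tm (n + 1)} {ρ : costModel.Env n}
    (h : HasType (ρ.con.ext A) M C) (hρ : EnvValid ρ)
    (hlt : ∀ a : Cost A, Valid a → Le 1 (costModel.pden M' (Model.Env.ext (𝓜 := costModel) ρ a) C)
      (costModel.pden M (Model.Env.ext (𝓜 := costModel) ρ a) C)) :
    Le 1 (costModel.den (.lam A M') ρ (.arr A C)) (costModel.den (.lam A M) ρ (.arr A C)) :=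
  le_of_pointwise (valid_den h.lam hρ) fun a ha => le_shift (hlt a ha) (le_refl _)

theorem den_appL_lt {n : ℕ} {A C : Ty} {M M' N : Tm n} {ρ : costModel.Env n}
    (hN : HasType ρ.con N A) (hρ : EnvValid ρ)
    (hlt : Le 1 (costModel.den M' ρ (.arr A C)) (costModel.den M ρ (.arr A C))) :
    Le 1 (costModel.den (.app M' N) ρ C) (costModel.den (.app M N) ρ C) := by
  rw [Model.den_app hN, Model.den_app hN]
  exact hlt 0 _ _ (valid_pden hN hρ) (valid_pden hN hρ) (valid_pden hN hρ)

theorem den_appR_lt {n : ℕ} {A C : Ty} {M N N' : Tm n} {ρ : costModel.Env n}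
    (hM : HasType ρ.con M (.arr A C)) (hN : HasType ρ.con N A) (hN' : HasType ρ.con N' A)
    (hρ : EnvValid ρ) (hlt : Le 1 (costModel.pden N' ρ A) (costModel.pden N ρ A)) :
    Le 1 (costModel.den (.app M N') ρ C) (costModel.den (.app M N) ρ C) := by
  rw [Model.den_app hN, Model.den_app hN']
  exact valid_den hM hρ 1 _ _ (valid_pden hN' hρ) (valid_pden hN hρ) hlt

theorem den_body_lt {n k : ℕ} {Δ : Con k} {C : Ty} {M M' : Tm k} {N : Fin k → Tm n}
    {ρ : costModel.Env n} (hN : ∀ i, HasType ρ.con (N i) (.box (Δ i))) (hρ : EnvValid ρ)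
    (hlt : ∀ ξ : costModel.Env k, ξ.con = Δ → EnvValid ξ →
      Le 1 (costModel.pden M' ξ C) (costModel.pden M ξ C)) :
    Le 1 (costModel.den (.letb M' N) ρ (.box C)) (costModel.den (.letb M N) ρ (.box C)) := by
  rw [den_box_apply hN, den_box_apply hN]
  exact le_shift (A := C) (hlt _ rfl fun i => valid_den (hN i) hρ) (by omega)

theorem den_entry_lt {n k : ℕ} {Δ : Con k} {C : Ty} {M : Tm k} {N : Fin k → Tm n} {i : Fin k}
    {P : Tm n} {ρ : costModel.Env n} (hN : ∀ i, HasType ρ.con (N i) (.box (Δ i)))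
    (hM : HasType Δ M C) (hP : HasType ρ.con P (.box (Δ i))) (hρ : EnvValid ρ)
    (hlt : Le 1 (costModel.den P ρ (.box (Δ i))) (costModel.den (N i) ρ (.box (Δ i)))) :
    Le 1 (costModel.den (.letb M (Function.update N i P)) ρ (.box C))
      (costModel.den (.letb M N) ρ (.box C)) := by
  have hN' : ∀ j, HasType ρ.con (Function.update N i P j) (.box (Δ j)) := fun j => by
    by_cases e : j = i
    · subst e; simpa using hP
    · simpa [e] using hN j
  have hlt' : ∀ j, Le 0 (costModel.den (Function.update N i P j) ρ (.box (Δ j)))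
      (costModel.den (N j) ρ (.box (Δ j))) := fun j => by
    by_cases e : j = i
    · subst e
      simp only [Function.update_self]
      exact hlt.mono (Nat.zero_le _)
    · simp only [Function.update_of_ne e]
      exact valid_den (hN j) hρ
  rw [den_box_apply hN, den_box_apply hN']
  have hs : ∑ j, (collapse (costModel.den (Function.update N i P j) ρ (.box (Δ j))) + 1) <
      ∑ j, (collapse (costModel.den (N j) ρ (.box (Δ j))) + 1) := by
    refine Finset.sum_lt_sum (fun j _ => Nat.succ_le_succ (hlt' j).collapse)
      ⟨i, Finset.mem_univ i, ?_⟩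
    have := hlt.collapse
    simp only [Function.update_self]
    omega
  refine le_shift (A := C) (n := 0) (Cost.Le.pos (den_mono M ?_ fun j => ?_)) (by omega)
  · exact hM
  · exact ⟨Δ j, _, _, rfl, rfl, valid_den (hN' j) hρ, valid_den (hN j) hρ, hlt' j⟩

/-- The argument in `β₁` and the entry in `β₂` may disappear or be copied; the summand that the
abstraction or the explicit substitution contributes accounts for the strict decrease. -/
theorem den_beta_lt {n : ℕ} {M M' : Tm n} (s : Beta M M') {ρ : costModel.Env n} {A : Ty}
    (h : HasType ρ.con M A) (hρ : EnvValid ρ) :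
    Le 1 (costModel.den M' ρ A) (costModel.den M ρ A) := by
  cases s with
  | beta1 B M N =>
    obtain ⟨C, h₁, h₂⟩ := h.app_inv
    obtain ⟨D, e, h₁'⟩ := h₁.lam_inv
    cases e
    have hN := valid_pden h₂ hρ
    have hle := (den_subst_le M (σ := Fin.cases N .var)
      (Model.Env.hasType_ext (𝓜 := costModel) (costModel.pden N ρ B) h₁') hρ fun i => by
        cases i using Fin.cases with
        | zero => exact ⟨B, _, rfl, h₂, hN, (valid_den h₂ hρ).le_pos _⟩
        | succ i =>
          refine ⟨_, _, rfl, .var i, hρ i, ?_⟩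
          change Le 0 (costModel.den (.var i) ρ _) _
          rw [Model.den_var (a := (ρ i).2) rfl]
          exact hρ i).1
    have hv := valid_den (Model.Env.hasType_ext (𝓜 := costModel) (costModel.pden N ρ B) h₁')
      (hρ.ext hN)
    rw [Model.den_app h₂]
    exact le_shift_right (hle.trans (hv.le_pos M.isIntro) hv)
      (show 1 ≤ 0 + 0 + (collapse (costModel.pden N ρ B) + 1) by omega)
  | @beta2 k m M P i R N e =>
    obtain ⟨Δ, C, rfl, h₁, h₂⟩ := h.letb_inv
    have hi := h₁ i
    rw [e] at hi
    obtain ⟨Θ, D, e', h₃, h₄⟩ := hi.letb_inv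
    cases e'
    have hT : ∀ j, HasType ρ.con (Fin.append (i.removeNth P) N j)
        (.box (Fin.append (i.removeNth Δ) Θ j)) := fun j => by
      cases j using Fin.addCases with
      | left j => simpa [Fin.removeNth] using h₁ (i.succAbove j)
      | right j => simpa using h₃ j
    -- `τ` is the environment in which the body of the contracted term is evaluated.
    let τ : costModel.Env (k + m) := fun l => ⟨Fin.append (i.removeNth Δ) Θ l,
      costModel.den (Fin.append (i.removeNth P) N l) ρ (.box (Fin.append (i.removeNth Δ) Θ l))⟩
    have hτ : EnvValid τ := fun l => valid_den (hT l) hρ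
    have eL : ∀ l, τ (Fin.castAdd m l) = ⟨Δ (i.succAbove l),
        costModel.den (P (i.succAbove l)) ρ (.box (Δ (i.succAbove l)))⟩ := fun l => by
      simp only [τ]
      rw [Fin.append_left, Fin.append_left]
      rfl
    have eR : ∀ l, τ (Fin.natAdd k l) = ⟨Θ l, costModel.den (N l) ρ (.box (Θ l))⟩ := fun l => by
      simp only [τ]
      rw [Fin.append_right, Fin.append_right]
    have cL : ∀ l, collapse (τ (Fin.castAdd m l)).2 =
        collapse (costModel.den (P (i.succAbove l)) ρ (.box (Δ (i.succAbove l)))) := fun l => by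
      rw [eL]; rfl
    have cR : ∀ l, collapse (τ (Fin.natAdd k l)).2 =
        collapse (costModel.den (N l) ρ (.box (Θ l))) := fun l => by
      rw [eR]; rfl
    have hPi := valid_den (h₁ i) hρ
    have ePi : costModel.den (P i) ρ (.box (Δ i)) =
        shift (A := Δ i) (∑ l, (collapse (costModel.den (N l) ρ (.box (Θ l))) + 1) + 1)
          (costModel.pden R (fun l => ⟨Θ l, costModel.den (N l) ρ (.box (Θ l))⟩) (Δ i)) := by
      rw [e, den_box_apply h₃]
    have cPi : ∑ l, (collapse (costModel.den (N l) ρ (.box (Θ l))) + 1) + 1 ≤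
        collapse (costModel.den (P i) ρ (.box (Δ i))) := by
      rw [ePi]
      exact (Nat.le_add_left _ _).trans_eq (collapse_shift (A := Δ i) _ _).symm
    have hR : Valid (costModel.den R (fun l => ⟨Θ l, costModel.den (N l) ρ (.box (Θ l))⟩) (Δ i)) :=
      valid_den h₄ fun l => valid_den (h₃ l) hρ
    have hle := (den_subst_le M (ρ := τ) (σ := graft i R)
      (ξ := fun j => ⟨Δ j, costModel.den (P j) ρ (.box (Δ j))⟩) h₂ hτ fun j => by
        refine ⟨Δ j, _, rfl, h₄.graft j, valid_den (h₁ j) hρ, ?_⟩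
        cases j using Fin.succAboveCases i with
        | x =>
          rw [graft, Fin.insertNth_apply_same, Model.den_rename, funext eR, ePi]
          exact le_shift_right (A := Δ i) (hR.le_pos _) (Nat.zero_le _)
        | p l =>
          rw [graft, Fin.insertNth_apply_succAbove, Model.den_var (eL l)]
          exact valid_den (h₁ _) hρ).2
    rw [den_box_apply h₁, den_box_apply hT, Fin.sum_univ_add, Fin.sum_univ_succAbove _ i]
    refine le_shift (A := C) hle ?_
    change 1 + (∑ l, (collapse (τ (Fin.castAdd m l)).2 + 1) +
      ∑ l, (collapse (τ (Fin.natAdd k l)).2 + 1) + 1) ≤ _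
    simp only [cL, cR]
    omega

theorem den_kappa_lt {n : ℕ} {M M' : Tm n} (s : Kappa M M') {ρ : costModel.Env n} {A : Ty}
    (h : HasType ρ.con M A) (hρ : EnvValid ρ) :
    Le 1 (costModel.den M' ρ A) (costModel.den M ρ A) := by
  cases s with
  | kappa1 M P i =>
    obtain ⟨Δ, C, rfl, h₁, h₂⟩ := h.letb_inv
    have h₁' : ∀ j, HasType ρ.con (i.removeNth P j) (.box (i.removeNth Δ j)) := fun j => h₁ _
    rw [den_box_apply h₁, den_box_apply h₁', Fin.sum_univ_succAbove _ i, Model.pden, Model.pden,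
      Model.den_rename, Tm.isIntro_rename]
    refine le_shift (A := C) (n := 0) (Cost.Le.pos (valid_den ?_ fun j => ?_)) ?_
    · exact (hasType_rename M i.succAbove).1 h₂
    · exact valid_den (h₁' j) hρ
    · simp only [Fin.removeNth]
      omega
  | kappa2 M P i j e =>
    obtain ⟨Δ, C, rfl, h₁, h₂⟩ := h.letb_inv
    have h₁' : ∀ j, HasType ρ.con (i.removeNth P j) (.box (i.removeNth Δ j)) := fun j => h₁ _
    have he : Δ i = Δ (i.succAbove j) := by
      have := h₁ i
      rw [e] at this
      exact Ty.box.inj (this.unique (h₁ _))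
    have hξ : (fun l => ⟨i.removeNth Δ (i.insertNth (α := fun _ => Fin _) j (fun l => l) l),
        costModel.den (i.removeNth P (i.insertNth (α := fun _ => Fin _) j (fun l => l) l)) ρ
          (.box (i.removeNth Δ (i.insertNth (α := fun _ => Fin _) j (fun l => l) l)))⟩ :
        costModel.Env _) = fun l => ⟨Δ l, costModel.den (P l) ρ (.box (Δ l))⟩ := by
      funext l
      cases l using Fin.succAboveCases i with
      | x =>
        rw [Fin.insertNth_apply_same]
        simp only [Fin.removeNth]
        rw [e, he]
      | p l => rw [Fin.insertNth_apply_succAbove]; rfl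
    rw [den_box_apply h₁, den_box_apply h₁', Fin.sum_univ_succAbove _ i, Model.pden,
      Model.den_rename, Tm.isIntro_rename, hξ]
    refine le_shift (A := C) (n := 0) (Cost.Le.pos (valid_den ?_ fun l => ?_)) ?_
    · exact h₂
    · exact valid_den (h₁ l) hρ
    · simp only [Fin.removeNth]
      omega

theorem den_compat_lt {R : ∀ {n : ℕ}, Tm n → Tm n → Prop}
    (hT : ∀ {n : ℕ} {M M' : Tm n}, R M M' →
      ∀ {Γ : Con n} {A : Ty}, HasType Γ M A → HasType Γ M' A)
    (hR : ∀ {n : ℕ} {M M' : Tm n}, R M M' → ∀ {ρ : costModel.Env n} {A : Ty},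
      HasType ρ.con M A → EnvValid ρ → Le 1 (costModel.den M' ρ A) (costModel.den M ρ A))
    (hI : ∀ {n : ℕ} {M M' : Tm n}, R M M' → M.isIntro = true → M'.isIntro = true)
    {n : ℕ} {M M' : Tm n} (s : Compat R M M') : ∀ {ρ : costModel.Env n} {A : Ty},
      HasType ρ.con M A → EnvValid ρ →
      Le 1 (costModel.den M' ρ A) (costModel.den M ρ A) ∧
        Le 1 (costModel.pden M' ρ A) (costModel.pden M ρ A) := by
  induction s with
  | ground s => intro ρ A h hρ; exact ⟨hR s h hρ, pden_lt h hρ (hI s) (hR s h hρ)⟩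
  | lam _ ih =>
    intro ρ A h hρ
    obtain ⟨C, rfl, h₁⟩ := h.lam_inv
    exact (and_self_iff).2 (den_lam_lt h₁ hρ fun a ha => (ih (Model.Env.hasType_ext _ h₁)
      (hρ.ext ha)).2)
  | appL _ ih =>
    intro ρ A h hρ
    obtain ⟨B, h₁, h₂⟩ := h.app_inv
    have := den_appL_lt h₂ hρ (ih h₁ hρ).1
    exact ⟨this, this.pos⟩
  | appR s ih =>
    intro ρ A h hρ
    obtain ⟨B, h₁, h₂⟩ := h.app_inv
    have := den_appR_lt h₁ h₂ (h₂.compat hT s) hρ (ih h₂ hρ).2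
    exact ⟨this, this.pos⟩
  | body _ ih =>
    intro ρ A h hρ
    obtain ⟨Δ, C, rfl, h₁, h₂⟩ := h.letb_inv
    exact (and_self_iff).2 (den_body_lt h₁ hρ fun ξ e hξ => (ih (e ▸ h₂) hξ).2)
  | entry i s ih =>
    intro ρ A h hρ
    obtain ⟨Δ, C, rfl, h₁, h₂⟩ := h.letb_inv
    exact (and_self_iff).2 (den_entry_lt h₁ h₂ ((h₁ i).compat hT s) hρ (ih (h₁ i) hρ).1)

/-- A term of boxed type is not itself `η₁`-expanded. -/
theorem Eta1.eq_false {n : ℕ} {Γ : Con n} {b : Bool} {M M' : Tm n} {A : Ty} (s : Eta1 Γ b M M')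
    (h : HasType Γ M (.box A)) : b = false := by
  cases s with
  | ground hM _ => exact nomatch hM.unique h
  | _ => rfl

/-- A term of arrow type is not itself `η₂`-expanded. -/
theorem Eta2.eq_false {n : ℕ} {Γ : Con n} {b : Bool} {M M' : Tm n} {A B : Ty} (s : Eta2 Γ b M M')
    (h : HasType Γ M (.arr A B)) : b = false := by
  cases s with
  | ground hM _ => exact nomatch hM.unique h
  | _ => rfl

/-- An expansion at the root decreases only the value that includes the charge for expansions; a
step below the root decreases both values. -/
theorem den_eta1_lt {n : ℕ} {Γ : Con n} {b : Bool} {M M' : Tm n} (s : Eta1 Γ b M M') :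
    ∀ {ρ : costModel.Env n} {A : Ty}, ρ.con = Γ → HasType Γ M A → EnvValid ρ →
      (b = false → Le 1 (costModel.den M' ρ A) (costModel.den M ρ A)) ∧
        Le 1 (costModel.pden M' ρ A) (costModel.pden M ρ A) := by
  induction s with
  | @ground n Γ M A B hM hI =>
    rintro ρ A' rfl h hρ
    obtain rfl := h.unique hM
    refine ⟨nofun, ?_⟩
    have hI' := isIntro_eq_false_of_arr hM hI
    rw [Model.pden, Model.pden, hI']
    refine le_of_pointwise (valid_den hM hρ).expand fun a ha => ?_
    have hv : HasType (Model.Env.con (Model.Env.ext (𝓜 := costModel) ρ a)) (.var 0) A :=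
      HasType.var (Γ := Model.Env.con (Model.Env.ext (𝓜 := costModel) ρ a)) 0
    change Le 1 (shift (collapse a + 1) (expand (costModel.den
      (.app (M.rename Fin.succ) (.var 0)) (Model.Env.ext (𝓜 := costModel) ρ a) B)))
      (shift (collapse a + 2) (expand _))
    rw [Model.den_app hv, Model.den_rename, Model.den_var (a := a) rfl]
    exact le_shift (n := 0) (valid_den hM hρ 0 _ _ ha.expand ha.expand ha.expand).expand
      (by omega)
  | lam s ih =>
    rintro ρ A rfl h hρ
    obtain ⟨C, rfl, h₁⟩ := h.lam_inv
    have := den_lam_lt h₁ hρ fun a ha => (ih (Model.Env.con_ext _ _) h₁ (hρ.ext ha)).2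
    exact ⟨fun _ => this, this⟩
  | appL s ih =>
    rintro ρ A rfl h hρ
    obtain ⟨B, h₁, h₂⟩ := h.app_inv
    have := den_appL_lt h₂ hρ ((ih rfl h₁ hρ).1 rfl)
    exact ⟨fun _ => this, this.pos⟩
  | appR s ih =>
    rintro ρ A rfl h hρ
    obtain ⟨B, h₁, h₂⟩ := h.app_inv
    have := den_appR_lt h₁ h₂ (h₂.eta1 s) hρ (ih rfl h₂ hρ).2
    exact ⟨fun _ => this, this.pos⟩
  | body hN s ih =>
    rintro ρ A rfl h hρ
    obtain ⟨Δ, C, rfl, h₁, h₂⟩ := h.letb_inv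
    obtain rfl := HasType.unique_box h₁ hN
    have := den_body_lt h₁ hρ fun ξ e hξ => (ih e h₂ hξ).2
    exact ⟨fun _ => this, this⟩
  | @entry n k Γ b M N i P s ih =>
    rintro ρ A rfl h hρ
    obtain ⟨Δ, C, rfl, h₁, h₂⟩ := h.letb_inv
    -- An entry has a boxed type, so that the step is not a root expansion of it.
    have := den_entry_lt h₁ h₂ ((h₁ i).eta1 s) hρ ((ih rfl (h₁ i) hρ).1 (s.eq_false (h₁ i)))
    exact ⟨fun _ => this, this⟩

theorem den_eta2_lt {n : ℕ} {Γ : Con n} {b : Bool} {M M' : Tm n} (s : Eta2 Γ b M M') :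
    ∀ {ρ : costModel.Env n} {A : Ty}, ρ.con = Γ → HasType Γ M A → EnvValid ρ →
      (b = false → Le 1 (costModel.den M' ρ A) (costModel.den M ρ A)) ∧
        Le 1 (costModel.pden M' ρ A) (costModel.pden M ρ A) := by
  induction s with
  | @ground n Γ M A hM hI =>
    rintro ρ A' rfl h hρ
    obtain rfl := h.unique hM
    refine ⟨nofun, ?_⟩
    have hI' := isIntro_eq_false_of_box hM hI
    rw [Model.pden, Model.pden, hI']
    change Le (A := A) 1 (costModel.den (Tm.letb (.var (0 : Fin 1)) fun _ => M) ρ (.box A))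
      (shift (A := A) (collapse (A := A) (costModel.den M ρ (.box A)) + 3)
        (expand (A := A) (costModel.den M ρ (.box A))))
    rw [den_box_apply (Δ := fun _ => A) fun _ => hM, Model.pden, Model.den_var rfl]
    refine le_shift (A := A) (n := 0) (Le.expand (A := A) (valid_den hM hρ)) ?_
    change 1 + (∑ _i : Fin 1, (collapse (costModel.den M ρ (.box A)) + 1) + 1) ≤
      0 + (collapse (costModel.den M ρ (.box A)) + 3)
    rw [Fin.sum_univ_one]
    omega
  | lam s ih =>
    rintro ρ A rfl h hρ
    obtain ⟨C, rfl, h₁⟩ := h.lam_inv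
    have := den_lam_lt h₁ hρ fun a ha => (ih (Model.Env.con_ext _ _) h₁ (hρ.ext ha)).2
    exact ⟨fun _ => this, this⟩
  | @appL n Γ b M M' N s ih =>
    rintro ρ A rfl h hρ
    obtain ⟨B, h₁, h₂⟩ := h.app_inv
    -- The function part has an arrow type, so that the step is not a root expansion of it.
    have := den_appL_lt h₂ hρ ((ih rfl h₁ hρ).1 (s.eq_false h₁))
    exact ⟨fun _ => this, this.pos⟩
  | appR s ih =>
    rintro ρ A rfl h hρ
    obtain ⟨B, h₁, h₂⟩ := h.app_inv
    have := den_appR_lt h₁ h₂ (h₂.eta2 s) hρ (ih rfl h₂ hρ).2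
    exact ⟨fun _ => this, this.pos⟩
  | body hN s ih =>
    rintro ρ A rfl h hρ
    obtain ⟨Δ, C, rfl, h₁, h₂⟩ := h.letb_inv
    obtain rfl := HasType.unique_box h₁ hN
    have := den_body_lt h₁ hρ fun ξ e hξ => (ih e h₂ hξ).2
    exact ⟨fun _ => this, this⟩
  | @entry n k Γ M N i P s ih =>
    rintro ρ A rfl h hρ
    obtain ⟨Δ, C, rfl, h₁, h₂⟩ := h.letb_inv
    have := den_entry_lt h₁ h₂ ((h₁ i).eta2 s) hρ ((ih rfl (h₁ i) hρ).1 rfl)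
    exact ⟨fun _ => this, this⟩

theorem pden_rawStep_lt {n : ℕ} {ρ : costModel.Env n} {M M' : Tm n} {A : Ty}
    (s : RawStep ρ.con M M') (h : HasType ρ.con M A) (hρ : EnvValid ρ) :
    Le 1 (costModel.pden M' ρ A) (costModel.pden M ρ A) := by
  rcases s with s | ⟨b, s⟩ | ⟨b, s⟩ | s
  · refine (den_compat_lt HasType.beta den_beta_lt (fun s => ?_) s h hρ).2
    cases s <;> intro h <;> first | exact h | rfl | cases h
  · exact (den_eta1_lt s rfl h hρ).2
  · exact (den_eta2_lt s rfl h hρ).2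
  · refine (den_compat_lt HasType.kappa den_kappa_lt (fun s => ?_) s h hρ).2
    cases s <;> intro h <;> rfl

/-- The cost of a term in the least environment of a context. -/
noncomputable def cost {n : ℕ} (Γ : Con n) (A : Ty) (M : Term n) : ℕ :=
  Quotient.lift (fun M : Tm n =>
      collapse (costModel.pden M (fun i => ⟨Γ i, Cost.zero (Γ i)⟩) A))
    (fun M M' (h : PermEq M M') => by
      simp only [Model.pden, h.isIntro_eq, Model.den_eq_of_permEq h]) M

theorem Typed.step {n : ℕ} {Γ : Con n} {A : Ty} {M N : Term n} (h : Typed Γ M A)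
    (s : Step Γ M N) : Typed Γ N A := by
  obtain ⟨M₁, e, h⟩ := h
  obtain ⟨M₀, N₀, rfl, rfl, s⟩ := s
  exact ⟨N₀, rfl, HasType.rawStep ((PermEq.hasType_iff (Quotient.exact e)).1 h) s⟩

theorem cost_step_lt {n : ℕ} {Γ : Con n} {A : Ty} {M N : Term n} (h : Typed Γ M A)
    (s : Step Γ M N) : cost Γ A N < cost Γ A M := by
  obtain ⟨M₁, e, h⟩ := h
  obtain ⟨M₀, N₀, rfl, rfl, s⟩ := s
  have h₀ := (PermEq.hasType_iff (Quotient.exact e)).1 h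
  exact (pden_rawStep_lt (ρ := (fun i => ⟨Γ i, Cost.zero (Γ i)⟩ : costModel.Env n)) s h₀
    fun i => valid_zero (Γ i)).collapse

/-! ### The residualizing model -/

/-- Codes of normal forms. Bound variables are named by their binding depth; a variable bound by
an explicit substitution is replaced by `unbox c z`, where `c` is the code of the entry and `z`
the binding depth of the substitution. -/
inductive Code : Type
  | v : ℕ → Code
  | lam : Ty → Code → Code
  | app : Code → Code → Code
  | box : Code → Code
  | unbox : Code → ℕ → Code

/-- Interpretation of types by sets. A boxed type is treated as a function type with domain `ℕ`,
and an element of an atomic type is a code for every binding depth. -/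
def Res : Ty → Type
  | .atom _ => ℕ → Code
  | .arr A B => Res A → Res B
  | .box A => ℕ → Res A

namespace Res

/-- The maps `reify` and `reflect`, defined together. -/
def reifyReflect : (A : Ty) → (Res A → ℕ → Code) × ((ℕ → Code) → Res A)
  | .atom _ => (fun a => a, fun t => t)
  | .arr A B => (fun f k =>
        .lam A ((reifyReflect B).1 (f ((reifyReflect A).2 fun _ => .v k)) (k + 1)),
      fun t a => (reifyReflect B).2 fun k => .app (t k) ((reifyReflect A).1 a k))
  | .box A => (fun f k => .box ((reifyReflect A).1 (f k) (k + 1)),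
      fun t z => (reifyReflect A).2 fun k => .unbox (t k) z)

/-- The code of a value at a given binding depth. -/
def reify {A : Ty} : Res A → ℕ → Code := (reifyReflect A).1

/-- The value of a neutral term, that is, one that is neither an abstraction nor an explicit
substitution, given by its codes. -/
def reflect {A : Ty} : (ℕ → Code) → Res A := (reifyReflect A).2

end Res

open Res

/-- The standard set-theoretic model, in which all the reduction rules are equalities. -/
def codeModel : Model where
  D := Res
  dflt _ := reflect fun _ => .v 0
  lam F := F
  app f a := f a
  box v f := fun z => f fun i => ⟨(v i).1, (v i).2 z⟩
  pos _ a := a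
  box_perm _ _ _ := rfl

theorem code_lam {n : ℕ} {A C : Ty} (M : Tm (n + 1)) (ρ : codeModel.Env n) :
    codeModel.den (.lam A M) ρ (.arr A C) =
      fun a : Res A => codeModel.den M (Model.Env.ext (𝓜 := codeModel) ρ a) C := rfl

theorem code_app {n : ℕ} {A C : Ty} {M N : Tm n} {ρ : codeModel.Env n} (h : HasType ρ.con N A) :
    codeModel.den (.app M N) ρ C =
      (codeModel.den M ρ (.arr A C) : Res A → Res C) (codeModel.den N ρ A) :=
  Model.den_app h

theorem code_letb {n k : ℕ} {Δ : Con k} {C : Ty} {M : Tm k} {N : Fin k → Tm n}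
    {ρ : codeModel.Env n} (h : ∀ i, HasType ρ.con (N i) (.box (Δ i))) :
    codeModel.den (.letb M N) ρ (.box C) = fun z : ℕ =>
      codeModel.den M
        (fun i => ⟨Δ i, (codeModel.den (N i) ρ (.box (Δ i)) : ℕ → Res (Δ i)) z⟩) C :=
  Model.den_letb h

theorem code_subst {n : ℕ} (M : Tm n) : ∀ {m : ℕ} {ρ : codeModel.Env m} {σ : Fin n → Tm m}
    {ξ : codeModel.Env n} {A : Ty}, HasType ξ.con M A →
    (∀ i, HasType ρ.con (σ i) (ξ i).1 ∧ codeModel.den (σ i) ρ (ξ i).1 = (ξ i).2) →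
    codeModel.den (M.subst σ) ρ A = codeModel.den M ξ A := by
  induction M with
  | var i =>
    intro m ρ σ ξ A h hσ
    obtain rfl := h.var_inv
    rw [Model.den_var rfl]
    exact (hσ i).2
  | lam B M ih =>
    intro m ρ σ ξ A h hσ
    obtain ⟨C, rfl, h₁⟩ := h.lam_inv
    rw [Tm.subst, code_lam, code_lam]
    funext a
    refine ih (Model.Env.hasType_ext (𝓜 := codeModel) a h₁) fun i => ?_
    cases i using Fin.cases with
    | zero =>
      exact ⟨HasType.var (Γ := Model.Env.con (Model.Env.ext (𝓜 := codeModel) ρ a)) 0,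
        Model.den_var rfl⟩
    | succ i => exact ⟨(hasType_rename _ _).2 (hσ i).1, (Model.den_rename _ _ _ _).trans (hσ i).2⟩
  | app M N ihM ihN =>
    intro m ρ σ ξ A h hσ
    obtain ⟨B, h₁, h₂⟩ := h.app_inv
    rw [Tm.subst, code_app h₂, code_app (h₂.subst fun i => (hσ i).1), ihM h₁ hσ, ihN h₂ hσ]
  | letb M N ihM ihN =>
    intro m ρ σ ξ A h hσ
    obtain ⟨Δ, C, rfl, h₁, h₂⟩ := h.letb_inv
    rw [Tm.subst, code_letb h₁, code_letb fun i => (h₁ i).subst fun i => (hσ i).1]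
    simp only [fun i => ihN i (h₁ i) hσ]
    rfl

theorem code_beta {n : ℕ} {M M' : Tm n} (s : Beta M M') {ρ : codeModel.Env n} {A : Ty}
    (h : HasType ρ.con M A) : codeModel.den M' ρ A = codeModel.den M ρ A := by
  cases s with
  | beta1 B M N =>
    obtain ⟨C, h₁, h₂⟩ := h.app_inv
    obtain ⟨D, e, h₁'⟩ := h₁.lam_inv
    cases e
    rw [code_app h₂, code_lam]
    refine code_subst M (Model.Env.hasType_ext (𝓜 := codeModel) _ h₁') fun i => ?_
    cases i using Fin.cases with
    | zero => exact ⟨h₂, rfl⟩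
    | succ i => exact ⟨.var i, Model.den_var rfl⟩
  | @beta2 k m M P i R N e =>
    obtain ⟨Δ, C, rfl, h₁, h₂⟩ := h.letb_inv
    have hi := h₁ i
    rw [e] at hi
    obtain ⟨Θ, D, e', h₃, h₄⟩ := hi.letb_inv
    cases e'
    have hT : ∀ j, HasType ρ.con (Fin.append (i.removeNth P) N j)
        (.box (Fin.append (i.removeNth Δ) Θ j)) := fun j => by
      cases j using Fin.addCases with
      | left j => simpa [Fin.removeNth] using h₁ (i.succAbove j)
      | right j => simpa using h₃ j
    rw [code_letb h₁, code_letb hT]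
    funext z
    refine code_subst M h₂ fun j => ⟨h₄.graft j, ?_⟩
    cases j using Fin.succAboveCases i with
    | x =>
      rw [graft, Fin.insertNth_apply_same, Model.den_rename, e, code_letb h₃]
      simp only
      congr 1
      funext l
      rw [Fin.append_right, Fin.append_right]
    | p l =>
      rw [graft, Fin.insertNth_apply_succAbove]
      refine Model.den_var ?_
      rw [Fin.append_left, Fin.append_left]
      rfl

theorem code_kappa {n : ℕ} {M M' : Tm n} (s : Kappa M M') {ρ : codeModel.Env n} {A : Ty}
    (h : HasType ρ.con M A) : codeModel.den M' ρ A = codeModel.den M ρ A := by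
  cases s with
  | kappa1 M P i =>
    obtain ⟨Δ, C, rfl, h₁, h₂⟩ := h.letb_inv
    have h₁' : ∀ j, HasType ρ.con (i.removeNth P j) (.box (i.removeNth Δ j)) := fun j => h₁ _
    rw [code_letb h₁, code_letb h₁']
    simp only [Model.den_rename]
    rfl
  | kappa2 M P i j e =>
    obtain ⟨Δ, C, rfl, h₁, h₂⟩ := h.letb_inv
    have h₁' : ∀ j, HasType ρ.con (i.removeNth P j) (.box (i.removeNth Δ j)) := fun j => h₁ _
    have he : Δ i = Δ (i.succAbove j) := by
      have := h₁ i
      rw [e] at this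
      exact Ty.box.inj (this.unique (h₁ _))
    rw [code_letb h₁, code_letb h₁']
    funext z
    rw [Model.den_rename]
    congr 1
    funext l
    cases l using Fin.succAboveCases i with
    | x =>
      rw [Fin.insertNth_apply_same]
      simp only [Fin.removeNth]
      rw [e, he]
    | p l => rw [Fin.insertNth_apply_succAbove]; rfl

theorem code_body {n k : ℕ} {Δ : Con k} {C : Ty} {M M' : Tm k} {N : Fin k → Tm n}
    {ρ : codeModel.Env n} (hN : ∀ i, HasType ρ.con (N i) (.box (Δ i)))
    (heq : ∀ ξ : codeModel.Env k, ξ.con = Δ → codeModel.den M' ξ C = codeModel.den M ξ C) :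
    codeModel.den (.letb M' N) ρ (.box C) = codeModel.den (.letb M N) ρ (.box C) := by
  rw [code_letb hN, code_letb hN]
  funext z
  exact heq _ rfl

theorem code_entry {n k : ℕ} {Δ : Con k} {C : Ty} {M : Tm k} {N : Fin k → Tm n} {i : Fin k}
    {P : Tm n} {ρ : codeModel.Env n} (hN : ∀ i, HasType ρ.con (N i) (.box (Δ i)))
    (hP : HasType ρ.con P (.box (Δ i)))
    (heq : codeModel.den P ρ (.box (Δ i)) = codeModel.den (N i) ρ (.box (Δ i))) :
    codeModel.den (.letb M (Function.update N i P)) ρ (.box C) =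
      codeModel.den (.letb M N) ρ (.box C) := by
  have hN' : ∀ j, HasType ρ.con (Function.update N i P j) (.box (Δ j)) := fun j => by
    by_cases e : j = i
    · subst e; simpa using hP
    · simpa [e] using hN j
  have : ∀ j, codeModel.den (Function.update N i P j) ρ (.box (Δ j)) =
      codeModel.den (N j) ρ (.box (Δ j)) := fun j => by
    by_cases e : j = i
    · subst e; rw [Function.update_self, heq]
    · rw [Function.update_of_ne e]
  rw [code_letb hN, code_letb hN']
  simp only [this]
  rfl

theorem code_compat {R : ∀ {n : ℕ}, Tm n → Tm n → Prop}
    (hT : ∀ {n : ℕ} {M M' : Tm n}, R M M' →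
      ∀ {Γ : Con n} {A : Ty}, HasType Γ M A → HasType Γ M' A)
    (hR : ∀ {n : ℕ} {M M' : Tm n}, R M M' → ∀ {ρ : codeModel.Env n} {A : Ty},
      HasType ρ.con M A → codeModel.den M' ρ A = codeModel.den M ρ A)
    {n : ℕ} {M M' : Tm n} (s : Compat R M M') : ∀ {ρ : codeModel.Env n} {A : Ty},
      HasType ρ.con M A → codeModel.den M' ρ A = codeModel.den M ρ A := by
  induction s with
  | ground s => intro ρ A h; exact hR s h
  | lam _ ih =>
    intro ρ A h
    obtain ⟨C, rfl, h₁⟩ := h.lam_inv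
    rw [code_lam, code_lam]
    funext a
    exact ih (Model.Env.hasType_ext _ h₁)
  | appL _ ih =>
    intro ρ A h
    obtain ⟨B, h₁, h₂⟩ := h.app_inv
    rw [code_app h₂, code_app h₂, ih h₁]
  | appR s ih =>
    intro ρ A h
    obtain ⟨B, h₁, h₂⟩ := h.app_inv
    rw [code_app h₂, code_app (h₂.compat hT s), ih h₂]
  | body _ ih =>
    intro ρ A h
    obtain ⟨Δ, C, rfl, h₁, h₂⟩ := h.letb_inv
    exact code_body h₁ fun ξ e => ih (e ▸ h₂)
  | entry i s ih =>
    intro ρ A h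
    obtain ⟨Δ, C, rfl, h₁, h₂⟩ := h.letb_inv
    exact code_entry h₁ ((h₁ i).compat hT s) (ih (h₁ i))

theorem code_eta1 {n : ℕ} {Γ : Con n} {b : Bool} {M M' : Tm n} (s : Eta1 Γ b M M') :
    ∀ {ρ : codeModel.Env n} {A : Ty}, ρ.con = Γ → HasType Γ M A →
      codeModel.den M' ρ A = codeModel.den M ρ A := by
  induction s with
  | @ground n Γ M A B hM _ =>
    rintro ρ A' rfl h
    obtain rfl := h.unique hM
    rw [code_lam]
    funext a
    have hv : HasType (Model.Env.con (Model.Env.ext (𝓜 := codeModel) ρ a)) (.var 0) A :=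
      HasType.var (Γ := Model.Env.con (Model.Env.ext (𝓜 := codeModel) ρ a)) 0
    rw [code_app hv, Model.den_rename, Model.den_var (a := a) rfl]
    rfl
  | lam s ih =>
    rintro ρ A rfl h
    obtain ⟨C, rfl, h₁⟩ := h.lam_inv
    rw [code_lam, code_lam]
    funext a
    exact ih (Model.Env.con_ext _ _) h₁
  | appL s ih =>
    rintro ρ A rfl h
    obtain ⟨B, h₁, h₂⟩ := h.app_inv
    rw [code_app h₂, code_app h₂, ih rfl h₁]
  | appR s ih =>
    rintro ρ A rfl h
    obtain ⟨B, h₁, h₂⟩ := h.app_inv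
    rw [code_app h₂, code_app (h₂.eta1 s), ih rfl h₂]
  | body hN s ih =>
    rintro ρ A rfl h
    obtain ⟨Δ, C, rfl, h₁, h₂⟩ := h.letb_inv
    obtain rfl := HasType.unique_box h₁ hN
    exact code_body h₁ fun ξ e => ih e h₂
  | entry i s ih =>
    rintro ρ A rfl h
    obtain ⟨Δ, C, rfl, h₁, h₂⟩ := h.letb_inv
    exact code_entry h₁ ((h₁ i).eta1 s) (ih rfl (h₁ i))

theorem code_eta2 {n : ℕ} {Γ : Con n} {b : Bool} {M M' : Tm n} (s : Eta2 Γ b M M') :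
    ∀ {ρ : codeModel.Env n} {A : Ty}, ρ.con = Γ → HasType Γ M A →
      codeModel.den M' ρ A = codeModel.den M ρ A := by
  induction s with
  | @ground n Γ M A hM _ =>
    rintro ρ A' rfl h
    obtain rfl := h.unique hM
    rw [code_letb (Δ := fun _ => A) fun _ => hM]
    funext z
    rw [Model.den_var rfl]
  | lam s ih =>
    rintro ρ A rfl h
    obtain ⟨C, rfl, h₁⟩ := h.lam_inv
    rw [code_lam, code_lam]
    funext a
    exact ih (Model.Env.con_ext _ _) h₁
  | appL s ih =>
    rintro ρ A rfl h
    obtain ⟨B, h₁, h₂⟩ := h.app_inv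
    rw [code_app h₂, code_app h₂, ih rfl h₁]
  | appR s ih =>
    rintro ρ A rfl h
    obtain ⟨B, h₁, h₂⟩ := h.app_inv
    rw [code_app h₂, code_app (h₂.eta2 s), ih rfl h₂]
  | body hN s ih =>
    rintro ρ A rfl h
    obtain ⟨Δ, C, rfl, h₁, h₂⟩ := h.letb_inv
    obtain rfl := HasType.unique_box h₁ hN
    exact code_body h₁ fun ξ e => ih e h₂
  | entry i s ih =>
    rintro ρ A rfl h
    obtain ⟨Δ, C, rfl, h₁, h₂⟩ := h.letb_inv
    exact code_entry h₁ ((h₁ i).eta2 s) (ih rfl (h₁ i))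

theorem code_rawStep {n : ℕ} {ρ : codeModel.Env n} {M M' : Tm n} {A : Ty}
    (s : RawStep ρ.con M M') (h : HasType ρ.con M A) :
    codeModel.den M' ρ A = codeModel.den M ρ A := by
  rcases s with s | ⟨b, s⟩ | ⟨b, s⟩ | s
  · exact code_compat HasType.beta code_beta s h
  · exact code_eta1 s rfl h
  · exact code_eta2 s rfl h
  · exact code_compat HasType.kappa code_kappa s h

/-! ### Normal forms are read off from their values -/

/-- The code of a term, given the codes of its free variables and the binding depth. -/
def read : {n : ℕ} → Tm n → (Fin n → ℕ → Code) → ℕ → Code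
  | _, .var i, σ, k => σ i k
  | _, .lam A M, σ, k => .lam A (read M (Fin.cases (fun _ => .v k) σ) (k + 1))
  | _, .app M N, σ, k => .app (read M σ k) (read N σ k)
  | _, .letb M N, σ, k => .box (read M (fun i l => .unbox (read (N i) σ l) k) (k + 1))

/-- The term has no `β`-step and no `η`-step, where an expansion of the whole term counts only if
the Boolean is `true`. -/
def BetaEtaNormal {n : ℕ} (Γ : Con n) (b : Bool) (M : Tm n) : Prop :=
  ∀ N, ¬ (Compat Beta M N ∨ ∃ b', (b' = true → b = true) ∧ (Eta1 Γ b' M N ∨ Eta2 Γ b' M N))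

namespace BetaEtaNormal

variable {n : ℕ} {Γ : Con n} {b : Bool}

theorem lam {A : Ty} {M : Tm (n + 1)} (h : BetaEtaNormal Γ b (.lam A M)) :
    BetaEtaNormal (Γ.ext A) true M := by
  rintro N (s | ⟨b', -, s | s⟩)
  · exact h _ (.inl s.lam)
  · exact h _ (.inr ⟨false, nofun, .inl s.lam⟩)
  · exact h _ (.inr ⟨false, nofun, .inr s.lam⟩)

theorem appL {M N : Tm n} (h : BetaEtaNormal Γ b (.app M N)) : BetaEtaNormal Γ false M := by
  rintro P (s | ⟨b', hb, s | s⟩)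
  · exact h _ (.inl s.appL)
  · obtain rfl : b' = false := by simpa using hb
    exact h _ (.inr ⟨false, nofun, .inl s.appL⟩)
  · exact h _ (.inr ⟨false, nofun, .inr s.appL⟩)

theorem appR {M N : Tm n} (h : BetaEtaNormal Γ b (.app M N)) : BetaEtaNormal Γ true N := by
  rintro P (s | ⟨b', -, s | s⟩)
  · exact h _ (.inl s.appR)
  · exact h _ (.inr ⟨false, nofun, .inl s.appR⟩)
  · exact h _ (.inr ⟨false, nofun, .inr s.appR⟩)

theorem body {k : ℕ} {Δ : Con k} {M : Tm k} {N : Fin k → Tm n}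
    (h : BetaEtaNormal Γ b (.letb M N)) (hN : ∀ i, HasType Γ (N i) (.box (Δ i))) :
    BetaEtaNormal Δ true M := by
  rintro P (s | ⟨b', -, s | s⟩)
  · exact h _ (.inl s.body)
  · exact h _ (.inr ⟨false, nofun, .inl (s.body hN)⟩)
  · exact h _ (.inr ⟨false, nofun, .inr (s.body hN)⟩)

theorem entry {k : ℕ} {M : Tm k} {N : Fin k → Tm n} (h : BetaEtaNormal Γ b (.letb M N))
    (i : Fin k) : BetaEtaNormal Γ false (N i) := by
  rintro P (s | ⟨b', hb, s | s⟩)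
  · exact h _ (.inl (s.entry i))
  · exact h _ (.inr ⟨false, nofun, .inl (s.entry i)⟩)
  · obtain rfl : b' = false := by simpa using hb
    exact h _ (.inr ⟨false, nofun, .inr (s.entry i)⟩)

theorem not_isLam {M N : Tm n} (h : BetaEtaNormal Γ b (.app M N)) : ¬ M.IsLam := by
  intro hM
  cases M with
  | lam A M => exact h _ (.inl (.ground (.beta1 A M N)))
  | _ => exact hM

theorem not_isLet {k : ℕ} {M : Tm k} {N : Fin k → Tm n} (h : BetaEtaNormal Γ b (.letb M N))
    (i : Fin k) : ¬ (N i).IsLet := by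
  intro hN
  cases k with
  | zero => exact i.elim0
  | succ k =>
    generalize e : N i = P at hN
    cases P with
    | letb R Q => exact h _ (.inl (.ground (.beta2 M N i R Q e)))
    | _ => exact hN

theorem eq_atom {M : Tm n} {A : Ty} (h : BetaEtaNormal Γ true M) (hM : HasType Γ M A)
    (hI : M.isIntro = false) : ∃ a, A = .atom a := by
  cases A with
  | atom a => exact ⟨a, rfl⟩
  | arr A B =>
    refine (h _ (.inr ⟨true, fun _ => rfl, .inl (.ground hM fun hL => ?_)⟩)).elim
    cases M with
    | lam => cases hI
    | _ => exact hL
  | box A =>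
    refine (h _ (.inr ⟨true, fun _ => rfl, .inr (.ground hM fun hL => ?_)⟩)).elim
    cases M with
    | letb => cases hI
    | _ => exact hL

end BetaEtaNormal

/-- A neutral `βη`-normal term is the reflection of its code, and the code of a `βη`-normal term
in a position where expansions are allowed is the reification of its value. -/
theorem den_eq_reflect_and_reify_den {n : ℕ} (M : Tm n) : ∀ {Γ : Con n} {A : Ty} {b : Bool}
    (σ : Fin n → ℕ → Code), HasType Γ M A → BetaEtaNormal Γ b M →
    (M.isIntro = false → codeModel.den M (fun i => ⟨Γ i, reflect (σ i)⟩) A = reflect (read M σ)) ∧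
      (b = true → reify (A := A) (codeModel.den M (fun i => ⟨Γ i, reflect (σ i)⟩) A) =
        read M σ) := by
  induction M with
  | var i =>
    intro Γ A b σ h hn
    obtain rfl := h.var_inv
    have : codeModel.den (.var i) (fun i => ⟨Γ i, reflect (σ i)⟩) (Γ i) =
        reflect (read (.var i) σ) := Model.den_var rfl
    refine ⟨fun _ => this, ?_⟩
    rintro rfl
    obtain ⟨a, e⟩ := hn.eq_atom h rfl
    rw [this, e]
    rfl
  | lam B M ih =>
    intro Γ A b σ h hn
    obtain ⟨C, rfl, h₁⟩ := h.lam_inv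
    refine ⟨nofun, fun _ => ?_⟩
    funext k
    have := (ih (Fin.cases (fun _ => .v k) σ) h₁ hn.lam).2 rfl
    rw [code_lam, read, ← this]
    change Code.lam B (reify (A := C) _ _) = _
    refine congrArg (fun ξ : codeModel.Env _ => Code.lam B (reify (codeModel.den M ξ C) (k + 1)))
      (funext fun i => ?_)
    cases i using Fin.cases <;> rfl
  | app M N ihM ihN =>
    intro Γ A b σ h hn
    obtain ⟨B, h₁, h₂⟩ := h.app_inv
    have : codeModel.den (.app M N) (fun i => ⟨Γ i, reflect (σ i)⟩) A =
        reflect (read (.app M N) σ) := by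
      rw [code_app (ρ := fun i => ⟨Γ i, reflect (σ i)⟩) h₂,
        (ihM σ h₁ hn.appL).1 (isIntro_eq_false_of_arr h₁ hn.not_isLam)]
      change reflect (fun k => Code.app (read M σ k) (reify (A := B) _ k)) = _
      rw [(ihN σ h₂ hn.appR).2 rfl]
      rfl
    refine ⟨fun _ => this, ?_⟩
    rintro rfl
    obtain ⟨a, rfl⟩ := hn.eq_atom h rfl
    rw [this]
    rfl
  | letb M N ihM ihN =>
    intro Γ A b σ h hn
    obtain ⟨Δ, C, rfl, h₁, h₂⟩ := h.letb_inv
    refine ⟨nofun, fun _ => ?_⟩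
    funext k
    have := (ihM (fun i l => .unbox (read (N i) σ l) k) h₂ (hn.body h₁)).2 rfl
    rw [code_letb (ρ := fun i => ⟨Γ i, reflect (σ i)⟩) h₁, read, ← this]
    change Code.box (reify (A := C) _ _) = _
    refine congrArg (fun ξ : codeModel.Env _ => Code.box (reify (codeModel.den M ξ C) (k + 1)))
      (funext fun i => ?_)
    rw [(ihN i σ (h₁ i) (hn.entry i)).1 (isIntro_eq_false_of_box (h₁ i) (hn.not_isLet i))]
    rfl

/-! ### Codes determine `κ`-normal terms -/

theorem read_rename {n : ℕ} (M : Tm n) : ∀ {m : ℕ} (r : Fin n → Fin m) (σ : Fin m → ℕ → Code),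
    read (M.rename r) σ = read M (fun i => σ (r i)) := by
  induction M with
  | var i => intros; rfl
  | lam A M ih =>
    intro m r σ
    funext k
    simp only [Tm.rename, read, ih, liftRen_comp_cases]
  | app M N ihM ihN => intro m r σ; funext k; simp only [Tm.rename, read, ihM, ihN]
  | letb M N ihM ihN => intro m r σ; funext k; simp only [Tm.rename, read, ihN]

theorem PermEq.read_eq {n : ℕ} {M M' : Tm n} (h : PermEq M M') : ∀ σ, read M σ = read M' σ := by
  induction h with
  | perm r M N => intro σ; funext k; simp only [read, read_rename]
  | lam _ ih => intro σ; funext k; simp only [read, ih]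
  | app _ _ ihM ihN => intro σ; funext k; simp only [read, ihM, ihN]
  | letb _ _ ihM ihN => intro σ; funext k; simp only [read, ihM, ihN]
  | refl => intro σ; rfl
  | symm _ ih => intro σ; exact (ih σ).symm
  | trans _ _ ih₁ ih₂ => intro σ; exact (ih₁ σ).trans (ih₂ σ)

/-- The variable occurs in the term. -/
def Occ : {n : ℕ} → Fin n → Tm n → Prop
  | _, i, .var j => j = i
  | _, i, .lam _ M => Occ i.succ M
  | _, i, .app M N => Occ i M ∨ Occ i N
  | _, i, .letb _ N => ∃ l, Occ i (N l)

/-- A term is a renaming of a term in those variables that occur in it. -/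
theorem exists_rename_eq {n : ℕ} (M : Tm n) : ∀ {m : ℕ} (r : Fin m → Fin n),
    (∀ i, Occ i M → ∃ j, r j = i) → ∃ M', M = Tm.rename M' r := by
  induction M with
  | var i =>
    intro m r h
    obtain ⟨j, rfl⟩ := h i rfl
    exact ⟨.var j, rfl⟩
  | lam A M ih =>
    intro m r h
    obtain ⟨M', rfl⟩ := ih (Tm.liftRen r) fun i hi => by
      cases i using Fin.cases with
      | zero => exact ⟨0, rfl⟩
      | succ i =>
        obtain ⟨j, rfl⟩ := h i hi
        exact ⟨j.succ, rfl⟩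
    exact ⟨.lam A M', rfl⟩
  | app M N ihM ihN =>
    intro m r h
    obtain ⟨M', rfl⟩ := ihM r fun i hi => h i (.inl hi)
    obtain ⟨N', rfl⟩ := ihN r fun i hi => h i (.inr hi)
    exact ⟨.app M' N', rfl⟩
  | letb M N ihM ihN =>
    intro m r h
    choose N' hN' using fun l => ihN l r fun i hi => h i ⟨l, hi⟩
    exact ⟨.letb M N', by rw [Tm.rename, funext hN']⟩

/-- In every explicit substitution, all the variables of the body occur and no two entries are
equal as modal lambda-terms. -/
def KappaNormal : {n : ℕ} → Tm n → Prop
  | _, .var _ => True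
  | _, .lam _ M => KappaNormal M
  | _, .app M N => KappaNormal M ∧ KappaNormal N
  | _, .letb M N => KappaNormal M ∧ (∀ i, KappaNormal (N i)) ∧ (∀ i, Occ i M) ∧
      ∀ i j, PermEq (N i) (N j) → i = j

/-- Equality of entries in `κ₂` is syntactic, so that steps of all permuted forms of the term have
to be excluded. -/
theorem kappaNormal_of_not_compat {n : ℕ} (M : Tm n) :
    (∀ M' N, PermEq M M' → ¬ Compat Kappa M' N) → KappaNormal M := by
  induction M with
  | var i => intro _; trivial
  | lam A M ih => intro h; exact ih fun M' N e s => h _ _ e.lam s.lam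
  | app M N ihM ihN =>
    intro h
    exact ⟨ihM fun M' P e s => h _ _ (e.app (.refl N)) s.appL,
      ihN fun N' P e s => h _ _ (.app (.refl M) e) s.appR⟩
  | @letb n k M N ihM ihN =>
    intro h
    refine ⟨ihM fun M' P e s => h _ _ (e.letb fun i => .refl (N i)) s.body,
      fun i => ihN i fun P Q e s => ?_, fun i => ?_, fun i j e => ?_⟩
    · have : (Function.update N i P) i = P := Function.update_self ..
      refine h (.letb M (Function.update N i P)) _ (.letb (.refl M) fun j => ?_)
        (.entry i (this.symm ▸ s))
      by_cases hj : j = i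
      · subst hj; rwa [Function.update_self]
      · rw [Function.update_of_ne hj]; exact .refl _
    · by_contra hi
      cases k with
      | zero => exact i.elim0
      | succ k =>
        obtain ⟨M', rfl⟩ := exists_rename_eq M i.succAbove fun j hj =>
          Fin.exists_succAbove_eq fun e => hi (e ▸ hj)
        exact h _ _ (.refl _) (.ground (.kappa1 M' N i))
    · by_contra hij
      cases k with
      | zero => exact i.elim0
      | succ k =>
        obtain ⟨l, rfl⟩ := Fin.exists_succAbove_eq (Ne.symm hij)
        refine h (.letb M (Function.update N i (N (i.succAbove l)))) _
          (.letb (.refl M) fun j => ?_) (.ground (.kappa2 M _ i l ?_))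
        · by_cases hj : j = i
          · subst hj; rwa [Function.update_self]
          · rw [Function.update_of_ne hj]; exact .refl _
        · rw [Function.update_self, Function.update_of_ne (Fin.succAbove_ne i l)]

/-- The code is of the form `v m` or `unbox c m`. -/
def Code.Atomic : Code → Prop
  | .v _ => True
  | .unbox _ _ => True
  | _ => False

/-- The codes of the variables look like variables, and the names of variables that will be bound
at binding depth at least `K` are not among them. -/
structure Fresh {n : ℕ} (σ : Fin n → ℕ → Code) (K : ℕ) : Prop where
  atomic : ∀ i k, (σ i k).Atomic
  ne_v : ∀ i k m, K ≤ m → σ i k ≠ .v m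

/-- Different variables have different codes at every binding depth from `K` on. -/
def Separated {n : ℕ} (σ : Fin n → ℕ → Code) (K : ℕ) : Prop :=
  ∀ i j k, K ≤ k → σ i k = σ j k → i = j

theorem Fresh.mono {n : ℕ} {σ : Fin n → ℕ → Code} {K L : ℕ} (h : Fresh σ K) (hKL : K ≤ L) :
    Fresh σ L :=
  ⟨h.atomic, fun i k m hm => h.ne_v i k m (hKL.trans hm)⟩

theorem Fresh.ext {n : ℕ} {σ : Fin n → ℕ → Code} {K : ℕ} (h : Fresh σ K) :
    Fresh (Fin.cases (fun _ => .v K) σ) (K + 1) := by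
  constructor
  · intro i k
    cases i using Fin.cases with
    | zero => trivial
    | succ i => exact h.atomic i k
  · intro i k m hm
    cases i using Fin.cases with
    | zero =>
      intro e
      cases e
      omega
    | succ i => exact h.ne_v i k m (by omega)

theorem fresh_unbox {k : ℕ} (c : Fin k → ℕ → Code) (z K : ℕ) :
    Fresh (fun i l => .unbox (c i l) z) K :=
  ⟨fun _ _ => trivial, fun _ _ _ _ => nofun⟩

theorem Fresh.comp {n m : ℕ} {σ : Fin n → ℕ → Code} {K : ℕ} (h : Fresh σ K) (r : Fin m → Fin n) :
    Fresh (fun i => σ (r i)) K :=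
  ⟨fun _ => h.atomic _, fun _ => h.ne_v _⟩

theorem Separated.mono {n : ℕ} {σ : Fin n → ℕ → Code} {K L : ℕ} (h : Separated σ K)
    (hKL : K ≤ L) : Separated σ L :=
  fun i j k hk => h i j k (hKL.trans hk)

theorem Separated.ext {n : ℕ} {σ : Fin n → ℕ → Code} {K : ℕ} (h : Separated σ K)
    (hf : Fresh σ K) : Separated (Fin.cases (fun _ => .v K) σ) (K + 1) := by
  intro i j k hk e
  cases i using Fin.cases with
  | zero =>
    cases j using Fin.cases with
    | zero => rfl
    | succ j => exact (hf.ne_v j k K le_rfl e.symm).elim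
  | succ i =>
    cases j using Fin.cases with
    | zero => exact (hf.ne_v i k K le_rfl e).elim
    | succ j => rw [h i j k (by omega) e]

theorem Separated.comp {n m : ℕ} {σ : Fin n → ℕ → Code} {K : ℕ} (h : Separated σ K)
    {r : Fin m → Fin n} (hr : Function.Injective r) : Separated (fun i => σ (r i)) K :=
  fun _ _ k hk e => hr (h _ _ k hk e)

theorem Fresh.read_var_eq {n m : ℕ} {σ : Fin n → ℕ → Code} {K k : ℕ} (h : Fresh σ K) {i : Fin n}
    {M : Tm m} {τ : Fin m → ℕ → Code} (e : σ i k = read M τ k) :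
    ∃ j, M = .var j ∧ σ i k = τ j k := by
  have ha := h.atomic i k
  cases M with
  | var j => exact ⟨j, rfl, e⟩
  | _ => rw [e] at ha; exact ha.elim

/-- The code of a `κ`-normal term mentions the codes of all the variables of the term. -/
theorem exists_code_eq_of_occ {n : ℕ} (M : Tm n) : ∀ {m : ℕ} {N : Tm m} {σ : Fin n → ℕ → Code}
    {τ : Fin m → ℕ → Code} {k : ℕ} {i : Fin n}, KappaNormal M → Fresh σ k → Fresh τ k →
    read M σ k = read N τ k → Occ i M → ∃ j l, k ≤ l ∧ σ i l = τ j l := by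
  induction M with
  | var i' =>
    rintro m N σ τ k i - hσ hτ e rfl
    obtain ⟨j, rfl, e⟩ := hσ.read_var_eq e
    exact ⟨j, k, le_rfl, e⟩
  | lam A M ih =>
    intro m N σ τ k i hM hσ hτ e hi
    cases N with
    | lam B N =>
      simp only [read, Code.lam.injEq] at e
      obtain ⟨j, l, hl, h⟩ := ih hM hσ.ext hτ.ext e.2 hi
      cases j using Fin.cases with
      | zero => exact (hσ.ne_v i l k le_rfl h).elim
      | succ j => exact ⟨j, l, by omega, h⟩
    | var j => exact nomatch (hτ.read_var_eq e.symm).choose_spec.1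
    | _ => exact nomatch e
  | app M₁ M₂ ih₁ ih₂ =>
    intro m N σ τ k i hM hσ hτ e hi
    cases N with
    | app N₁ N₂ =>
      simp only [read, Code.app.injEq] at e
      rcases hi with hi | hi
      · exact ih₁ hM.1 hσ hτ e.1 hi
      · exact ih₂ hM.2 hσ hτ e.2 hi
    | var j => exact nomatch (hτ.read_var_eq e.symm).choose_spec.1
    | _ => exact nomatch e
  | letb M P ihM ihP =>
    intro m N σ τ k i hM hσ hτ e hi
    obtain ⟨hM, hP, hocc, -⟩ := hM
    obtain ⟨l, hi⟩ := hi
    cases N with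
    | letb N Q =>
      simp only [read, Code.box.injEq] at e
      obtain ⟨j, k', hk', h⟩ := ihM hM (fresh_unbox _ _ _) (fresh_unbox _ _ _) e (hocc l)
      simp only [Code.unbox.injEq, and_true] at h
      obtain ⟨j, k'', hk'', h⟩ := ihP l (hP l) (hσ.mono (by omega)) (hτ.mono (by omega)) h hi
      exact ⟨j, k'', by omega, h⟩
    | var j => exact nomatch (hτ.read_var_eq e.symm).choose_spec.1
    | _ => exact nomatch e

/-- `κ`-normal terms with the same code are equal up to permutations. The injective renaming `r`
allows for the two bodies of explicit substitutions listing their variables in different order. -/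
theorem permEq_of_read_eq {n : ℕ} (M : Tm n) : ∀ {m : ℕ} {N : Tm m} {r : Fin n → Fin m}
    {σ : Fin m → ℕ → Code} {k : ℕ}, Function.Injective r → KappaNormal M → KappaNormal N →
    Fresh σ k → Separated σ k → read M (fun i => σ (r i)) k = read N σ k →
    PermEq (M.rename r) N := by
  induction M with
  | var i =>
    intro m N r σ k hr hM hN hf hs e
    obtain ⟨j, rfl, e⟩ := (hf.comp r).read_var_eq e
    rw [← hs _ _ k le_rfl e]
    exact .refl _
  | lam A M ih =>
    intro m N r σ k hr hM hN hf hs e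
    cases N with
    | lam B N =>
      simp only [read, Code.lam.injEq] at e
      obtain ⟨rfl, e⟩ := e
      refine .lam (ih ?_ hM hN hf.ext (hs.ext hf) ?_)
      · intro i j h
        cases i using Fin.cases with
        | zero =>
          cases j using Fin.cases with
          | zero => rfl
          | succ j => exact (Fin.succ_ne_zero _ h.symm).elim
        | succ i =>
          cases j using Fin.cases with
          | zero => exact (Fin.succ_ne_zero _ h).elim
          | succ j => exact congrArg Fin.succ (hr (Fin.succ_injective _ h))
      · rw [liftRen_comp_cases]
        exact e
    | var j => exact nomatch (hf.read_var_eq e.symm).choose_spec.1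
    | _ => exact nomatch e
  | app M₁ M₂ ih₁ ih₂ =>
    intro m N r σ k hr hM hN hf hs e
    cases N with
    | app N₁ N₂ =>
      simp only [read, Code.app.injEq] at e
      exact .app (ih₁ hr hM.1 hN.1 hf hs e.1) (ih₂ hr hM.2 hN.2 hf hs e.2)
    | var j => exact nomatch (hf.read_var_eq e.symm).choose_spec.1
    | _ => exact nomatch e
  | @letb n k₁ M P ihM ihP =>
    intro m N r σ k hr hM hN hf hs e
    cases N with
    | @letb _ k₂ N Q =>
      obtain ⟨hM, hP, hoccM, hdistM⟩ := hM
      obtain ⟨hN, hQ, hoccN, hdistN⟩ := hN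
      simp only [read, Code.box.injEq] at e
      -- Two entries on the left with the same code at some depth coincide.
      have hPinj : ∀ i i' l, k ≤ l → read (P i) (fun i => σ (r i)) l =
          read (P i') (fun i => σ (r i)) l → i = i' := fun i i' l hl h => by
        have := ihP i (r := fun i => i) Function.injective_id (hP i) (hP i')
          ((hf.mono hl).comp r) ((hs.mono hl).comp hr) h
        rw [rename_id] at this
        exact hdistM i i' this
      -- The variables of the bodies are matched by means of their codes.
      have hex : ∀ i, ∃ j, PermEq ((P i).rename r) (Q j) := fun i => by
        obtain ⟨j, l, hl, h⟩ := exists_code_eq_of_occ M hM (fresh_unbox _ _ _)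
          (fresh_unbox _ _ _) e (hoccM i)
        simp only [Code.unbox.injEq, and_true] at h
        exact ⟨j, ihP i hr (hP i) (hQ j) (hf.mono (by omega)) (hs.mono (by omega)) h⟩
      choose f hf' using hex
      have hread : ∀ i l, read (P i) (fun i => σ (r i)) l = read (Q (f i)) σ l := fun i l => by
        rw [← (hf' i).read_eq, read_rename]
      have hinj : Function.Injective f := fun i i' h =>
        hPinj i i' k le_rfl (by rw [hread, hread, h])
      have hsurj : Function.Surjective f := fun j => by
        obtain ⟨i, l, hl, h⟩ := exists_code_eq_of_occ N hN (fresh_unbox _ _ _)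
          (fresh_unbox _ _ _) e.symm (hoccN j)
        simp only [Code.unbox.injEq, and_true] at h
        have := ihP i hr (hP i) (hQ j) (hf.mono (by omega)) (hs.mono (by omega)) h.symm
        exact ⟨i, hdistN _ _ ((hf' i).symm.trans this)⟩
      obtain rfl : k₁ = k₂ := by
        simpa using Fintype.card_congr (Equiv.ofBijective f ⟨hinj, hsurj⟩)
      have hbody : PermEq (M.rename f) N := by
        refine ihM hinj hM hN (fresh_unbox (fun j l => read (Q j) σ l) k (k + 1)) ?_ ?_
        · intro j j' l hl h
          obtain ⟨i, rfl⟩ := hsurj j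
          obtain ⟨i', rfl⟩ := hsurj j'
          simp only [Code.unbox.injEq, and_true] at h
          rw [hPinj i i' l (by omega) (by rw [hread, hread, h])]
        · simpa only [hread] using e
      have hperm := PermEq.perm (Equiv.ofBijective f ⟨hinj, hsurj⟩) M Q
      exact (PermEq.letb (.refl M) hf').trans
        (hperm.symm.trans (PermEq.letb hbody fun i => .refl (Q i)))
    | var j => exact nomatch (hf.read_var_eq e.symm).choose_spec.1
    | _ => exact nomatch e

/-! ### Confluence -/

/-- The value of a modal lambda-term in the set-theoretic model, where every free variable stands
for itself. -/
noncomputable def value {n : ℕ} (Γ : Con n) (A : Ty) (M : Term n) : Res A :=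
  Quotient.lift (fun M : Tm n => codeModel.den M (fun i => ⟨Γ i, reflect fun _ => .v i⟩) A)
    (fun _ _ h => Model.den_eq_of_permEq h _ _) M

theorem value_eq_of_steps {n : ℕ} {Γ : Con n} {A : Ty} {M N : Term n} (h : Typed Γ M A)
    (s : Relation.ReflTransGen (Step Γ) M N) : Typed Γ N A ∧ value Γ A N = value Γ A M := by
  induction s with
  | refl => exact ⟨h, rfl⟩
  | tail _ s ih =>
    refine ⟨ih.1.step s, .trans ?_ ih.2⟩
    obtain ⟨M₁, e, h⟩ := ih.1
    obtain ⟨M₀, N₀, rfl, rfl, s⟩ := s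
    exact code_rawStep (ρ := (fun i => ⟨Γ i, reflect fun _ => .v i⟩ : codeModel.Env n)) s
      ((PermEq.hasType_iff (Quotient.exact e)).1 h)

theorem exists_normal {n : ℕ} {Γ : Con n} {A : Ty} : ∀ {M : Term n}, Typed Γ M A →
    ∃ N, Relation.ReflTransGen (Step Γ) M N ∧ ∀ P, ¬ Step Γ N P := by
  intro M
  induction hc : cost Γ A M using Nat.strong_induction_on generalizing M with
  | _ c ih =>
    intro h
    by_cases hs : ∃ P, Step Γ M P
    · obtain ⟨P, hs⟩ := hs
      obtain ⟨N, hN, hN'⟩ := ih _ (hc ▸ cost_step_lt h hs) rfl (h.step hs)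
      exact ⟨N, .head hs hN, hN'⟩
    · exact ⟨M, .refl, not_exists.1 hs⟩

theorem read_eq_reify_value {n : ℕ} {Γ : Con n} {A : Ty} {M : Tm n} (h : HasType Γ M A)
    (hM : ∀ P, ¬ Step Γ (.mk M) P) :
    read M (fun i _ => .v i) = reify (value Γ A (.mk M)) ∧ KappaNormal M := by
  have hs : ∀ M' N, PermEq M M' → ¬ RawStep Γ M' N := fun M' N e s =>
    hM (.mk N) ⟨M', N, Quotient.sound e.symm, rfl, s⟩
  refine ⟨((den_eq_reflect_and_reify_den M (b := true) (fun i _ => .v i) h fun N => ?_).2 rfl).symm,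
    kappaNormal_of_not_compat M fun M' N e s => hs M' N e (.inr (.inr (.inr s)))⟩
  rintro (s | ⟨b, -, s | s⟩)
  · exact hs M N (.refl M) (.inl s)
  · exact hs M N (.refl M) (.inr (.inl ⟨b, s⟩))
  · exact hs M N (.refl M) (.inr (.inr (.inl ⟨b, s⟩)))

/-- Normal terms of the same type with the same value are equal. -/
theorem eq_of_value_eq {n : ℕ} {Γ : Con n} {A : Ty} {M N : Term n} (hM : Typed Γ M A)
    (hN : Typed Γ N A) (hM' : ∀ P, ¬ Step Γ M P) (hN' : ∀ P, ¬ Step Γ N P)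
    (e : value Γ A M = value Γ A N) : M = N := by
  obtain ⟨M, rfl, hM⟩ := hM
  obtain ⟨N, rfl, hN⟩ := hN
  obtain ⟨hM₁, hM₂⟩ := read_eq_reify_value hM hM'
  obtain ⟨hN₁, hN₂⟩ := read_eq_reify_value hN hN'
  have := permEq_of_read_eq M (r := fun i => i) (k := n) (σ := fun i _ => .v i)
    Function.injective_id hM₂ hN₂ ⟨fun _ _ => trivial, fun i k m hm e => by
      cases e
      omega⟩ (fun i j k _ e => Fin.ext (Code.v.inj e)) (by rw [hM₁, hN₁, e])
  rw [rename_id] at this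
  exact Quotient.sound this

end ModalLambda

theorem mainTheorem1 {n : ℕ} (Γ : Con n) (A : Ty) (M : Term n) (hM : Typed Γ M A) :
    (¬ ∃ f : ℕ → Term n, f 0 = M ∧ ∀ k, Step Γ (f k) (f (k + 1))) ∧
    (∀ N₁ N₂ : Term n, Relation.ReflTransGen (Step Γ) M N₁ → Relation.ReflTransGen (Step Γ) M N₂ →
      ∃ P : Term n, Relation.ReflTransGen (Step Γ) N₁ P ∧ Relation.ReflTransGen (Step Γ) N₂ P) := by
  constructor
  · rintro ⟨f, rfl, hf⟩
    have ht : ∀ k, Typed Γ (f k) A := fun k => by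
      induction k with
      | zero => exact hM
      | succ k ih => exact ih.step (hf k)
    have hc : ∀ k, cost Γ A (f k) + k ≤ cost Γ A (f 0) := fun k => by
      induction k with
      | zero => exact le_rfl
      | succ k ih =>
        have := cost_step_lt (ht k) (hf k)
        omega
    have := hc (cost Γ A (f 0) + 1)
    omega
  · intro N₁ N₂ s₁ s₂
    obtain ⟨h₁, e₁⟩ := value_eq_of_steps hM s₁
    obtain ⟨h₂, e₂⟩ := value_eq_of_steps hM s₂
    obtain ⟨P₁, t₁, n₁⟩ := exists_normal h₁
    obtain ⟨P₂, t₂, n₂⟩ := exists_normal h₂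
    obtain ⟨h₁', e₁'⟩ := value_eq_of_steps h₁ t₁
    obtain ⟨h₂', e₂'⟩ := value_eq_of_steps h₂ t₂
    obtain rfl := eq_of_value_eq h₁' h₂' n₁ n₂ (by rw [e₁', e₂', e₁, e₂])
    exact ⟨P₁, t₁, t₂⟩
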